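/- For $n \ge 1$ let $Q_n$ be the hypercube graph with vertex set $\{-1,1\}^n \subset \mathbb{R}^n$, in which $x$ and $y$ are adjacent when $\sum_{i=1}^n |x_i - y_i| = 2$; each edge is identified with the line segment joining its endpoints. A hyperplane in $\mathbb{R}^n$ \emph{dissects} an edge if it intersects the edge but contains neither of its endpoints. Let $H(n)$ be the minimum number of hyperplanes in $\mathbb{R}^n$ such that every edge of $Q_n$ is dissected by at least one of them. Then $H(n) \ge \Omega\bigl(n^{2/3}/\log(n)^{4/3}\bigr)$; that is, there is an absolute constant $c > 0$ such that for every integer $n \ge 2$, $$H(n) \;\ge\; c\,\frac{n^{2/3}}{(\log n)^{4/3}}.$$ -/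

import Mathlib

/-- The ambient Euclidean space of dimension `n`. -/
abbrev RSpace (n : ℕ) : Type := EuclideanSpace ℝ (Fin n)

/-- The vertices of the `n`-cube: the points all of whose coordinates are `1` or `-1`. -/
def CubeVertex (n : ℕ) : Type := {x : RSpace n // ∀ i, x i = 1 ∨ x i = -1}

/-- The hypercube graph: vertices `x`, `y` are adjacent when `∑ i, |x i - y i| = 2`,
that is, when they differ in exactly one coordinate. -/
def hypercubeGraph (n : ℕ) : SimpleGraph (CubeVertex n) where
  Adj x y := ∑ i, |x.1 i - y.1 i| = 2
  symm := ⟨fun x y h => by simpa only [abs_sub_comm] using h⟩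
  loopless := ⟨fun x h => by simp at h⟩

/-- A hyperplane: the solution set of `⟪v, x⟫ = t` for a unit normal vector `v` and a real `t`. -/
def IsHyperplane {n : ℕ} (S : Set (RSpace n)) : Prop :=
  ∃ (v : RSpace n) (t : ℝ), ‖v‖ = 1 ∧ S = {x | inner ℝ v x = t}

/-- `S` dissects the edge with endpoints `x` and `y`: it meets the edge (a line segment), but
contains neither of its endpoints. -/
def Dissects {n : ℕ} (S : Set (RSpace n)) (x y : RSpace n) : Prop :=
  (S ∩ segment ℝ x y).Nonempty ∧ x ∉ S ∧ y ∉ S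

/-- `A` is a finite set of hyperplanes such that every edge of the `n`-cube is dissected by a
member of `A`. -/
def DissectsAllEdges {n : ℕ} (A : Finset (Set (RSpace n))) : Prop :=
  (∀ S ∈ A, IsHyperplane S) ∧
    ∀ x y : CubeVertex n, (hypercubeGraph n).Adj x y → ∃ S ∈ A, Dissects S x.1 y.1

/-- The minimum number of hyperplanes that dissect all edges of the `n`-cube. -/
noncomputable def minHyperplanes (n : ℕ) : ℕ :=
  sInf {m : ℕ | ∃ A : Finset (Set (RSpace n)), A.card = m ∧ DissectsAllEdges A}

/-- The `n` coordinate hyperplanes dissect all edges, so the set of which `minHyperplanes` is the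
infimum is nonempty. -/
theorem exists_dissectsAllEdges (n : ℕ) :
    ∃ A : Finset (Set (RSpace n)), DissectsAllEdges A := by
  classical
  refine ⟨Finset.univ.image fun i : Fin n =>
    {x : RSpace n | inner ℝ (EuclideanSpace.single i (1 : ℝ)) x = 0}, ?_, ?_⟩
  · intro S hS
    obtain ⟨i, -, rfl⟩ := Finset.mem_image.1 hS
    exact ⟨EuclideanSpace.single i 1, 0, by simp, rfl⟩
  · intro x y hxy
    have hex : ∃ i, x.1 i ≠ y.1 i := by
      by_contra! h
      have h2 : ∑ i, |x.1 i - y.1 i| = 2 := hxy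
      simp [h] at h2
    obtain ⟨i, hi⟩ := hex
    refine ⟨_, Finset.mem_image_of_mem _ (Finset.mem_univ i), ?_, ?_, ?_⟩
    · refine ⟨(1 / 2 : ℝ) • x.1 + (1 / 2 : ℝ) • y.1, ?_, 1 / 2, 1 / 2, by norm_num, by norm_num,
        by norm_num, rfl⟩
      rcases x.2 i with hx | hx <;> rcases y.2 i with hy | hy <;>
        simp_all [EuclideanSpace.inner_single_left]
    · rcases x.2 i with hx | hx <;> simp [EuclideanSpace.inner_single_left, hx]
    · rcases y.2 i with hy | hy <;> simp [EuclideanSpace.inner_single_left, hy]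

/-- `minHyperplanes n` is an attained minimum. -/
theorem minHyperplanes_isLeast (n : ℕ) :
    IsLeast {m : ℕ | ∃ A : Finset (Set (RSpace n)), A.card = m ∧ DissectsAllEdges A}
      (minHyperplanes n) := by
  obtain ⟨A, hA⟩ := exists_dissectsAllEdges n
  exact ⟨Nat.sInf_mem ⟨A.card, A, rfl, hA⟩, fun m hm => Nat.sInf_le hm⟩

/-! Let `m` hyperplanes with normals `v j` be given. When `m ^ (3 / 2) * (log n) ^ 2` is small
against `n`, an edge that none of them separates is found inside a subcube, spanned at a vertex `X`
by a set `G` of directions.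

Choice of `X` and `G`. Group the nonzero entries of each normal by order of magnitude in base `q = 2
* n`. A random vertex lies within `q ^ (i + 2)` of a hyperplane for only boundedly many of its
scales `i` on average, so one vertex `X` is good for all hyperplanes together. Attach to each close
scale a logarithmic energy of size `O(log n)`. Minimizing total energy minus a multiple of the size
of `G` yields a nonempty `G` on which deleting any coordinate costs little energy
(`exists_vertex_exists_spread_coordinates`). Hence, for the active hyperplanes (those within `2 * ∑
l ∈ G, |v j l|` of `X`), the normals restricted to `G` and normalized have columns of squared norm
at most `lam`, of order `m * log n / n`. An inactive hyperplane misses the whole subcube.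

Choice of the edge. Bang's lemma (`exists_far_from_hyperplanes`) gives a point of the solid subcube
at distance at least `1 / √(m * lam)` from all active hyperplanes with nonzero restricted normal. A
derandomized Gram–Schmidt walk (`exists_rounding_abs_sum_le`) rounds it to a vertex, moving it by
only `O(log m * √lam)` in each normal direction. An edge in a direction of `G` moves by at most `2 *
√lam`, so it is not separated if `log m * lam * √m` is below a constant. Substituting `lam` gives
the exponents `2 / 3` and `4 / 3`. -/

/-! ### Vector balancing by a derandomized Gram–Schmidt walk. -/

section VectorBalancing

/-- The algebraic inequality behind the monotonicity of the walk potential. -/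
lemma sq_add_mul_inv_sub_le {g h s T z y : ℝ} (hz : 0 ≤ z) (hT : 0 ≤ T) (hZ : z + T ≤ 1)
    (hy : y ^ 2 ≤ 1) (hh : h ^ 2 ≤ s ^ 2 * T) (hg : z = 0 → g = 0) :
    (g + h) ^ 2 * (1 / (z + T) - y ^ 2) ≤ s ^ 2 + g ^ 2 * (1 / z - y ^ 2) := by
  rcases hT.eq_or_lt with rfl | hT
  · have h0 : h = 0 := by
      have : h ^ 2 ≤ 0 := by simpa using hh
      exact pow_eq_zero_iff (two_ne_zero) |>.1 (le_antisymm this (sq_nonneg h))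
    subst h0
    simp only [add_zero]
    nlinarith [sq_nonneg s]
  rcases hz.eq_or_lt with rfl | hz
  · have h0 := hg rfl
    subst h0
    have h1 : h ^ 2 * (1 / T) ≤ s ^ 2 := by
      rw [mul_one_div, div_le_iff₀ hT]; exact hh
    simp only [zero_add]
    nlinarith [mul_nonneg (sq_nonneg h) (sq_nonneg y)]
  have hz1 : z < 1 := by linarith
  have hY := sq_nonneg y
  set Y := y ^ 2 with hYd
  have hYz : 0 < 1 - Y * z := by nlinarith
  have hα : 1 / z - Y = (1 - Y * z) / z := by field_simp
  have hαpos : 0 < (1 - Y * z) / z := div_pos hYz hz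
  set α := (1 - Y * z) / z with hαd
  -- Weighted Cauchy–Schwarz, splitting `g` as `(g * √α) * (1 / √α)` and bounding `|h|` by `|s| *
  -- √T`.
  have hcs : (g + h) ^ 2 ≤ (g ^ 2 * α + s ^ 2) * (1 / α + T) := by
    have e : (g ^ 2 * α + s ^ 2) * (1 / α + T)
        = g ^ 2 + (g ^ 2 * (α * T) + s ^ 2 * (1 / α)) + s ^ 2 * T := by
      field_simp
      ring
    rw [e]
    have h2 : 2 * (g * h) ≤ g ^ 2 * (α * T) + s ^ 2 * (1 / α) := by
      have hαT : 0 < α * T := mul_pos hαpos hT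
      have h3 : s ^ 2 * (1 / α) ≥ h ^ 2 / (α * T) := by
        rw [ge_iff_le, div_le_iff₀ hαT]
        have : s ^ 2 * (1 / α) * (α * T) = s ^ 2 * T := by field_simp
        rw [this]; exact hh
      have h4 : 2 * (g * h) ≤ g ^ 2 * (α * T) + h ^ 2 / (α * T) := by
        have : g ^ 2 * (α * T) + h ^ 2 / (α * T) - 2 * (g * h)
            = (g * (α * T) - h) ^ 2 / (α * T) := by
          field_simp
          ring
        have h5 : 0 ≤ (g * (α * T) - h) ^ 2 / (α * T) := by positivity
        linarith
      linarith
    nlinarith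
  have hZpos : 0 < z + T := by linarith
  have hβ : 1 / (z + T) - Y = (1 - Y * (z + T)) / (z + T) := by field_simp
  have hβ0 : 0 ≤ 1 - Y * (z + T) := by nlinarith
  have hprod : (1 / α + T) * (1 / (z + T) - Y) ≤ 1 := by
    have e : (1 / α + T) * (1 / (z + T) - Y)
        = ((z + T - Y * z * T) * (1 - Y * (z + T))) / ((1 - Y * z) * (z + T)) := by
      rw [hβ, hαd]
      field_simp
      ring
    -- Denominator minus numerator equals `Y * T * (z + T + z - Y * (z * (z + T)))`.
    rw [e, div_le_one (by positivity)]
    have h6 : Y * (z * (z + T)) ≤ z := by nlinarith [mul_nonneg hY hz.le]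
    nlinarith [mul_nonneg (mul_nonneg hY hT.le) (by linarith : 0 ≤ z + T + z - Y * (z * (z + T)))]
  have hβn : 0 ≤ 1 / (z + T) - Y := by rw [hβ]; positivity
  have hA : 0 ≤ g ^ 2 * α + s ^ 2 := by positivity
  rw [hα]
  calc (g + h) ^ 2 * (1 / (z + T) - Y)
      ≤ (g ^ 2 * α + s ^ 2) * (1 / α + T) * (1 / (z + T) - Y) :=
        mul_le_mul_of_nonneg_right hcs hβn
    _ = (g ^ 2 * α + s ^ 2) * ((1 / α + T) * (1 / (z + T) - Y)) := by ring
    _ ≤ (g ^ 2 * α + s ^ 2) * 1 := mul_le_mul_of_nonneg_left hprod hA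
    _ = s ^ 2 + g ^ 2 * α := by ring

/-- The second derivative is the function times `g ^ 2 * ((1 - 2 * y * g) ^ 2 - 2)`. With `|y * g| ≤
1 / 5` the square is at most `1.96`; this is the source of the constant `1 / 5`. Concavity is what
replaces the random step of the walk by a deterministic one. -/
lemma concaveOn_exp_mul_sub_sq {g : ℝ} (hg : |g| ≤ 1 / 5) :
    ConcaveOn ℝ (Set.Icc (-1) 1) fun y : ℝ => Real.exp (y * g - y ^ 2 * g ^ 2) := by
  have h1 : ∀ y : ℝ, HasDerivAt (fun y : ℝ => y * g - y ^ 2 * g ^ 2) (g - 2 * y * g ^ 2) y := by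
    intro y
    have := ((hasDerivAt_id y).mul_const g).sub (((hasDerivAt_id y).pow 2).mul_const (g ^ 2))
    exact this.congr_deriv (by simp)
  have h2 : ∀ y : ℝ, HasDerivAt (fun y : ℝ => g - 2 * y * g ^ 2) (-2 * g ^ 2) y := by
    intro y
    have := (((hasDerivAt_id y).const_mul 2).mul_const (g ^ 2)).const_sub g
    exact this.congr_deriv (by simp)
  refine concaveOn_of_hasDerivWithinAt2_nonpos (convex_Icc _ _) (by fun_prop)
    (f' := fun y => Real.exp (y * g - y ^ 2 * g ^ 2) * (g - 2 * y * g ^ 2))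
    (f'' := fun y => Real.exp (y * g - y ^ 2 * g ^ 2) * (g - 2 * y * g ^ 2) * (g - 2 * y * g ^ 2)
      + Real.exp (y * g - y ^ 2 * g ^ 2) * (-2 * g ^ 2))
    (fun y _ => (h1 y).exp.hasDerivWithinAt)
    (fun y _ => ((h1 y).exp.mul (h2 y)).hasDerivWithinAt) ?_
  intro y hy
  rw [interior_Icc] at hy
  have hyg : |y * g| ≤ 1 / 5 := by
    rw [abs_mul]
    have : |y| ≤ 1 := abs_le.2 ⟨hy.1.le, hy.2.le⟩
    nlinarith [abs_nonneg g, abs_nonneg y]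
  obtain ⟨ha, hb⟩ := abs_le.1 hyg
  have e : Real.exp (y * g - y ^ 2 * g ^ 2) * (g - 2 * y * g ^ 2) * (g - 2 * y * g ^ 2)
      + Real.exp (y * g - y ^ 2 * g ^ 2) * (-2 * g ^ 2)
      = - (Real.exp (y * g - y ^ 2 * g ^ 2) * g ^ 2 * (2 - (1 - 2 * (y * g)) ^ 2)) := by ring
  rw [e]
  have : 0 ≤ 2 - (1 - 2 * (y * g)) ^ 2 := by nlinarith
  have := Real.exp_pos (y * g - y ^ 2 * g ^ 2)
  have : 0 ≤ Real.exp (y * g - y ^ 2 * g ^ 2) * g ^ 2 * (2 - (1 - 2 * (y * g)) ^ 2) := by positivity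
  linarith

variable {E : Type*} [NormedAddCommGroup E] [InnerProductSpace ℝ E] [FiniteDimensional ℝ E]

/-- The component of `b` orthogonal to `V`. -/
noncomputable def orthPart (V : Submodule ℝ E) (b : E) : E := b - V.starProjection b

/-- The potential of the Gram–Schmidt walk: `V` is the span of the alive vectors other than the
pivot `b`, and `y` is the current coefficient of the pivot. -/
noncomputable def walkPotential (V : Submodule ℝ E) (b : E) (y : ℝ) (θ : E) : ℝ :=
  ‖V.starProjection θ‖ ^ 2 + inner ℝ θ (orthPart V b) ^ 2 * (1 / ‖orthPart V b‖ ^ 2 - y ^ 2)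

lemma inner_orthPart_of_mem (V : Submodule ℝ E) (b : E) {w : E} (hw : w ∈ V) :
    inner ℝ (orthPart V b) w = 0 :=
  V.starProjection_inner_eq_zero b w hw

lemma norm_orthPart_le (V : Submodule ℝ E) (b : E) : ‖orthPart V b‖ ≤ ‖b‖ := by
  have h := norm_add_sq_real (orthPart V b) (V.starProjection b)
  rw [inner_orthPart_of_mem V b (V.starProjection_apply_mem b)] at h
  have e : orthPart V b + V.starProjection b = b := by simp [orthPart]
  rw [e] at h
  exact (pow_le_pow_iff_left₀ (norm_nonneg _) (norm_nonneg _) two_ne_zero).1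
    (by nlinarith [sq_nonneg ‖V.starProjection b‖])

lemma starProjection_of_le {V W : Submodule ℝ E} (h : V ≤ W) (x : E) :
    V.starProjection (W.starProjection x) = V.starProjection x := by
  have := V.starProjection_comp_starProjection_of_le h
  exact congrArg (fun f => f x) this

lemma inner_starProjection_sub_of_mem {V W : Submodule ℝ E} (h : V ≤ W) (x : E) {w : E}
    (hw : w ∈ V) : inner ℝ (W.starProjection x - V.starProjection x) w = 0 := by
  rw [← starProjection_of_le h x]
  exact V.starProjection_inner_eq_zero _ w hw

lemma norm_sq_starProjection_eq_add {V W : Submodule ℝ E} (h : V ≤ W) (x : E) :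
    ‖W.starProjection x‖ ^ 2
      = ‖V.starProjection x‖ ^ 2 + ‖W.starProjection x - V.starProjection x‖ ^ 2 := by
  have h1 := norm_add_sq_real (W.starProjection x - V.starProjection x) (V.starProjection x)
  rw [inner_starProjection_sub_of_mem h x (V.starProjection_apply_mem x), sub_add_cancel] at h1
  linarith

lemma inner_eq_inner_starProjection_of_mem (W : Submodule ℝ E) (x : E) {w : E} (hw : w ∈ W) :
    inner ℝ x w = inner ℝ (W.starProjection x) w := by
  have := W.starProjection_inner_eq_zero x w hw
  rw [inner_sub_left] at this
  linarith

/-- Freezing a coordinate other than the pivot shrinks the span, and this must not raise the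
potential. The residual of `b` gains a component `q` orthogonal to the old residual, and the claim
becomes `sq_add_mul_inv_sub_le`. -/
lemma walkPotential_mono {V W : Submodule ℝ E} (h : V ≤ W) {b : E} (hb : ‖b‖ ≤ 1) {y : ℝ}
    (hy : y ^ 2 ≤ 1) (θ : E) : walkPotential V b y θ ≤ walkPotential W b y θ := by
  set q := W.starProjection b - V.starProjection b with hq
  set t := W.starProjection θ - V.starProjection θ with ht
  have hqW : q ∈ W := W.sub_mem (W.starProjection_apply_mem b) (h (V.starProjection_apply_mem b))
  have hr : orthPart V b = orthPart W b + q := by simp [orthPart, hq]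
  have hn : ‖orthPart V b‖ ^ 2 = ‖orthPart W b‖ ^ 2 + ‖q‖ ^ 2 := by
    rw [hr, norm_add_sq_real, inner_orthPart_of_mem W b hqW]
    ring
  have hi : inner ℝ θ (orthPart V b) = inner ℝ θ (orthPart W b) + inner ℝ θ q := by
    rw [hr, inner_add_right]
  have hθq : inner ℝ θ q = inner ℝ t q := by
    have h0 : inner ℝ (V.starProjection θ) q = 0 := by
      rw [real_inner_comm]
      exact inner_starProjection_sub_of_mem h b (V.starProjection_apply_mem θ)
    rw [inner_eq_inner_starProjection_of_mem W θ hqW, ht, inner_sub_left, h0, sub_zero]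
  have hcs : inner ℝ θ q ^ 2 ≤ ‖t‖ ^ 2 * ‖q‖ ^ 2 := by
    rw [hθq, ← mul_pow]
    exact sq_le_sq' (neg_le_of_abs_le (abs_real_inner_le_norm t q)) (real_inner_le_norm t q)
  have hle : ‖orthPart W b‖ ^ 2 + ‖q‖ ^ 2 ≤ 1 := by
    rw [← hn]
    exact pow_le_one₀ (norm_nonneg _) ((norm_orthPart_le V b).trans hb)
  have := sq_add_mul_inv_sub_le (g := inner ℝ θ (orthPart W b)) (s := ‖t‖) (sq_nonneg _)
    (sq_nonneg _) hle hy hcs (fun h0 => by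
      have : orthPart W b = 0 := by simpa using h0
      simp [this])
  unfold walkPotential
  rw [hi, hn, norm_sq_starProjection_eq_add h θ]
  linarith

lemma one_div_norm_sq_orthPart_sub_nonneg (V : Submodule ℝ E) {b : E} (hb : ‖b‖ ≤ 1) {y : ℝ}
    (hy : y ^ 2 ≤ 1) (h0 : orthPart V b ≠ 0) : 0 ≤ 1 / ‖orthPart V b‖ ^ 2 - y ^ 2 := by
  have h1 : 0 < ‖orthPart V b‖ := norm_pos_iff.2 h0
  have h2 : ‖orthPart V b‖ ^ 2 ≤ 1 := pow_le_one₀ h1.le ((norm_orthPart_le V b).trans hb)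
  have : 1 ≤ 1 / ‖orthPart V b‖ ^ 2 := by rw [le_div_iff₀ (by positivity)]; linarith
  linarith

lemma norm_sq_starProjection_le_walkPotential (V : Submodule ℝ E) {b : E} (hb : ‖b‖ ≤ 1) {y : ℝ}
    (hy : y ^ 2 ≤ 1) (θ : E) : ‖V.starProjection θ‖ ^ 2 ≤ walkPotential V b y θ := by
  unfold walkPotential
  by_cases h0 : orthPart V b = 0
  · simp [h0]
  · have := one_div_norm_sq_orthPart_sub_nonneg V hb hy h0
    nlinarith [mul_nonneg (sq_nonneg (inner ℝ θ (orthPart V b))) this]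

/-- Bessel's inequality: the residual of `b` lies in `W` and is orthogonal to `V`. Together with
`norm_sq_starProjection_le_walkPotential` it handles a change of pivot, since `‖W.starProjection θ‖
^ 2` lies between the new and the old potential. -/
lemma walkPotential_le_norm_sq_starProjection {V W : Submodule ℝ E} (h : V ≤ W) {b : E}
    (hb : b ∈ W) (y : ℝ) (θ : E) : walkPotential V b y θ ≤ ‖W.starProjection θ‖ ^ 2 := by
  have hr : orthPart V b ∈ W := W.sub_mem hb (h (V.starProjection_apply_mem b))
  unfold walkPotential
  rw [norm_sq_starProjection_eq_add h θ]
  set t := W.starProjection θ - V.starProjection θ with ht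
  by_cases h0 : orthPart V b = 0
  · simp [h0]
  have hpos : 0 < ‖orthPart V b‖ ^ 2 := by positivity
  have hθ : inner ℝ θ (orthPart V b) = inner ℝ t (orthPart V b) := by
    have h0 : inner ℝ (V.starProjection θ) (orthPart V b) = 0 := by
      rw [real_inner_comm]
      exact inner_orthPart_of_mem V b (V.starProjection_apply_mem θ)
    rw [inner_eq_inner_starProjection_of_mem W θ hr, ht, inner_sub_left, h0, sub_zero]
  have hcs : inner ℝ θ (orthPart V b) ^ 2 ≤ ‖t‖ ^ 2 * ‖orthPart V b‖ ^ 2 := by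
    rw [hθ, ← mul_pow]
    exact sq_le_sq' (neg_le_of_abs_le (abs_real_inner_le_norm t _)) (real_inner_le_norm t _)
  have : inner ℝ θ (orthPart V b) ^ 2 * (1 / ‖orthPart V b‖ ^ 2) ≤ ‖t‖ ^ 2 := by
    rw [mul_one_div, div_le_iff₀ hpos]; exact hcs
  nlinarith [mul_nonneg (sq_nonneg (inner ℝ θ (orthPart V b))) (sq_nonneg y)]

/-- Moving from a point of the cube in a direction that is nonzero at some alive coordinate, one
can stop inside the cube with a further coordinate equal to `±1`. -/
lemma exists_step_to_boundary {ι : Type*} (A : Finset ι) (x u : ι → ℝ)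
    (hx : ∀ k ∈ A, |x k| < 1) {p : ι} (hp : p ∈ A) (hup : u p ≠ 0) :
    ∃ δ : ℝ, 0 ≤ δ ∧ (∀ k ∈ A, |x k + δ * u k| ≤ 1) ∧ ∃ k ∈ A, |x k + δ * u k| = 1 := by
  classical
  have hne : (A.filter fun k => u k ≠ 0).Nonempty := ⟨p, by simp [hp, hup]⟩
  -- `d k` is the time at which coordinate `k` reaches the face it is heading for; the smallest such
  -- time is the step length.
  set d : ι → ℝ := fun k => (1 - x k * SignType.sign (u k)) / |u k| with hd
  obtain ⟨k, hk, hmin⟩ := Finset.exists_min_image _ d hne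
  rw [Finset.mem_filter] at hk
  have key : ∀ l ∈ A, u l ≠ 0 → ∀ δ, x l + δ * u l
      = SignType.sign (u l) * (1 + (δ - d l) * |u l|) := by
    intro l _ hul δ
    have h1 : 0 < |u l| := abs_pos.2 hul
    have h2 : d l * |u l| = 1 - x l * SignType.sign (u l) := by
      rw [hd]; field_simp
    rcases lt_or_gt_of_ne hul with h | h
    · rw [sign_neg h] at h2 ⊢
      rw [abs_of_neg h] at h2 ⊢
      push_cast [SignType.coe_one] at h2 ⊢
      linarith
    · rw [sign_pos h] at h2 ⊢
      rw [abs_of_pos h] at h2 ⊢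
      push_cast [SignType.coe_one] at h2 ⊢
      linarith
  have hdpos : ∀ l ∈ A, u l ≠ 0 → 0 ≤ d l := by
    intro l hl hul
    have hxl := abs_lt.1 (hx l hl)
    apply div_nonneg _ (abs_nonneg _)
    rcases lt_or_gt_of_ne hul with h | h
    · rw [sign_neg h]; push_cast [SignType.coe_one]; linarith
    · rw [sign_pos h]; push_cast [SignType.coe_one]; linarith
  refine ⟨d k, hdpos k hk.1 hk.2, ?_, k, hk.1, ?_⟩
  · intro l hl
    by_cases hul : u l = 0
    · simpa [hul] using (hx l hl).le
    have h1 : 0 < |u l| := abs_pos.2 hul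
    have h2 : d k ≤ d l := hmin l (by simp [hl, hul])
    have h3 := hdpos k hk.1 hk.2
    have hxl := abs_lt.1 (hx l hl)
    have e := key l hl hul
    rcases lt_or_gt_of_ne hul with h | h
    · have e1 := e (d k)
      have : d k * u l ≤ 0 := mul_nonpos_of_nonneg_of_nonpos h3 h.le
      rw [sign_neg h] at e1
      push_cast [SignType.coe_one] at e1
      have : (d k - d l) * |u l| ≤ 0 := mul_nonpos_of_nonpos_of_nonneg (by linarith) h1.le
      rw [abs_le]; constructor <;> linarith
    · have e1 := e (d k)
      have : 0 ≤ d k * u l := mul_nonneg h3 h.le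
      rw [sign_pos h] at e1
      push_cast [SignType.coe_one] at e1
      have : (d k - d l) * |u l| ≤ 0 := mul_nonpos_of_nonpos_of_nonneg (by linarith) h1.le
      rw [abs_le]; constructor <;> linarith
  · rw [key k hk.1 hk.2]
    rcases lt_or_gt_of_ne hk.2 with h | h
    · simp [sign_neg h]
    · simp [sign_pos h]

/-- The Gram–Schmidt walk, derandomized for a finite family of exponential moments: `A` contains
the alive coordinates other than the pivot `p`. -/
theorem exists_rounding_sum_exp_le_walkPotential {ι κ : Type*} [Fintype ι]
    (s : Finset κ) (θ : κ → E) (hθ : ∀ i ∈ s, ‖θ i‖ ≤ 1 / 5)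
    (b : ι → E) (hb : ∀ k, ‖b k‖ ≤ 1) (N : ℕ) : ∀ (A : Finset ι) (p : ι) (w : κ → ℝ) (x : ι → ℝ),
    A.card = N → p ∉ A → (∀ i ∈ s, 0 ≤ w i) → (∀ k, |x k| ≤ 1) →
    (∀ k, k ∉ A → k ≠ p → |x k| = 1) →
    ∃ ε : ι → ℝ, (∀ k, |ε k| = 1) ∧ (∀ k, |x k| = 1 → ε k = x k) ∧
      ∑ i ∈ s, w i * Real.exp (inner ℝ (θ i) (∑ k, (ε k - x k) • b k)) ≤
        ∑ i ∈ s, w i * Real.exp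
          (walkPotential (Submodule.span ℝ (b '' A)) (b p) (x p) (θ i)) := by
  classical
  induction N using Nat.strong_induction_on with
  | _ N ih =>
  intro A p w x hA hpA hw hx hfix
  have hsq : ∀ (x : ι → ℝ), (∀ k, |x k| ≤ 1) → ∀ k, x k ^ 2 ≤ 1 := fun x hx k =>
    (sq_le_one_iff_abs_le_one _).2 (hx k)
  -- Once an alive coordinate is `±1` it can be dropped and induction applies. The weights and the
  -- point are quantified afresh because this is also used after a move.
  have frozen : ∀ (w : κ → ℝ) (x : ι → ℝ), (∀ i ∈ s, 0 ≤ w i) → (∀ k, |x k| ≤ 1) →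
      (∀ k, k ∉ A → k ≠ p → |x k| = 1) → (∃ k ∈ insert p A, |x k| = 1) →
      ∃ ε : ι → ℝ, (∀ k, |ε k| = 1) ∧ (∀ k, |x k| = 1 → ε k = x k) ∧
      ∑ i ∈ s, w i * Real.exp (inner ℝ (θ i) (∑ k, (ε k - x k) • b k)) ≤
        ∑ i ∈ s, w i * Real.exp
          (walkPotential (Submodule.span ℝ (b '' A)) (b p) (x p) (θ i)) := by
    rintro w x hw hx hfix ⟨k, hk, hxk⟩
    rcases Finset.mem_insert.1 hk with rfl | hkA
    · rcases A.eq_empty_or_nonempty with rfl | ⟨q, hq⟩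
      · refine ⟨x, fun l => ?_, fun _ _ => rfl, Finset.sum_le_sum fun i hi => ?_⟩
        · by_cases h : l = k
          · rw [h, hxk]
          · exact hfix l (by simp) h
        · refine mul_le_mul_of_nonneg_left (Real.exp_le_exp.2 ?_) (hw i hi)
          simp only [sub_self, zero_smul, Finset.sum_const_zero, inner_zero_right]
          exact (sq_nonneg _).trans
            (norm_sq_starProjection_le_walkPotential _ (hb k) (hsq x hx k) (θ i))
      · obtain ⟨ε, h1, h2, h3⟩ := ih (A.erase q).card
          (by rw [← hA]; exact Finset.card_erase_lt_of_mem hq) (A.erase q) q w x rfl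
          (Finset.notMem_erase q A) hw hx (fun l hl hlq => by
            by_cases h : l = k
            · rw [h, hxk]
            · exact hfix l (fun hlA => hl (Finset.mem_erase.2 ⟨hlq, hlA⟩)) h)
        refine ⟨ε, h1, h2, h3.trans (Finset.sum_le_sum fun i hi =>
          mul_le_mul_of_nonneg_left (Real.exp_le_exp.2 ?_) (hw i hi))⟩
        refine (walkPotential_le_norm_sq_starProjection (W := Submodule.span ℝ (b '' A))
          (Submodule.span_mono (Set.image_mono (Finset.coe_subset.2 (A.erase_subset q))))
          (Submodule.subset_span ⟨q, hq, rfl⟩) _ _).trans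
          (norm_sq_starProjection_le_walkPotential _ (hb k) (hsq x hx k) (θ i))
    · obtain ⟨ε, h1, h2, h3⟩ := ih (A.erase k).card
          (by rw [← hA]; exact Finset.card_erase_lt_of_mem hkA) (A.erase k) p w x rfl
          (fun h => hpA (Finset.mem_of_mem_erase h)) hw hx (fun l hl hlp => by
            by_cases h : l = k
            · rw [h, hxk]
            · exact hfix l (fun hlA => hl (Finset.mem_erase.2 ⟨h, hlA⟩)) hlp)
      refine ⟨ε, h1, h2, h3.trans (Finset.sum_le_sum fun i hi =>
          mul_le_mul_of_nonneg_left (Real.exp_le_exp.2 ?_) (hw i hi))⟩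
      exact walkPotential_mono
        (Submodule.span_mono (Set.image_mono (Finset.coe_subset.2 (A.erase_subset k))))
        (hb p) (hsq x hx p) (θ i)
  by_cases hal : ∃ k ∈ insert p A, |x k| = 1
  · exact frozen w x hw hx hfix hal
  push Not at hal
  have hlt : ∀ k ∈ insert p A, |x k| < 1 := fun k hk => lt_of_le_of_ne (hx k) (hal k hk)
  set V := Submodule.span ℝ (b '' A) with hV
  set r := orthPart V (b p) with hr
  -- The walk direction: the pivot moves at unit speed and the other alive coordinates cancel the
  -- part of `b p` lying in `V`, so the vector sum moves along `r`.
  obtain ⟨u, hup, hu0, hur⟩ : ∃ u : ι → ℝ, u p = 1 ∧ (∀ k, k ∉ insert p A → u k = 0) ∧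
      ∑ k, u k • b k = r := by
    have hm : V.starProjection (b p) ∈ V := V.starProjection_apply_mem _
    rw [hV, Submodule.mem_span_image_finset_iff_exists_fun'] at hm
    obtain ⟨c, hc⟩ := hm
    refine ⟨fun k => if k = p then 1 else if k ∈ A then - c k else 0, by simp, ?_, ?_⟩
    · intro k hk
      rw [Finset.mem_insert, not_or] at hk
      simp [hk.1, hk.2]
    · have e : ∀ k, (if k = p then (1 : ℝ) else if k ∈ A then - c k else 0) • b k
          = (if k = p then b k else 0) - (if k ∈ A then c k • b k else 0) := by
        intro k
        by_cases h1 : k = p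
        · subst h1; simp [hpA]
        · by_cases h2 : k ∈ A <;> simp [h1, h2]
      simp only [e, Finset.sum_sub_distrib]
      rw [Finset.sum_ite_eq' Finset.univ p b, ← Finset.sum_filter, Finset.filter_mem_eq_inter,
        Finset.univ_inter, hr, orthPart]
      simp only [Finset.mem_univ, if_true]
      rw [← hc]
  set g : κ → ℝ := fun i => inner ℝ (θ i) r with hg
  have hgle : ∀ i ∈ s, |g i| ≤ 1 / 5 := fun i hi =>
    (abs_real_inner_le_norm _ _).trans (by
      have h1 := (norm_orthPart_le V (b p)).trans (hb p)
      calc ‖θ i‖ * ‖r‖ ≤ 1 / 5 * 1 :=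
            mul_le_mul (hθ i hi) h1 (norm_nonneg _) (by norm_num)
        _ = 1 / 5 := by norm_num)
  -- All factors that do not depend on the pivot coefficient `y`. The exponential of the
  -- displacement is absorbed into the weights, leaving only `exp (y * g i - y ^ 2 * g i ^ 2)`.
  set C : κ → ℝ := fun i => w i * Real.exp (‖V.starProjection (θ i)‖ ^ 2
    + g i ^ 2 * (1 / ‖r‖ ^ 2) - x p * g i) with hC
  set T : ℝ → ℝ := fun y => ∑ i ∈ s, C i * Real.exp (y * g i - y ^ 2 * g i ^ 2) with hT
  have hTconc : ConcaveOn ℝ (Set.Icc (-1) 1) T := by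
    have : T = ∑ i ∈ s, fun y => C i * Real.exp (y * g i - y ^ 2 * g i ^ 2) := by
      ext y; simp [hT]
    rw [this]
    refine Finset.sum_induction _ (fun f : ℝ → ℝ => ConcaveOn ℝ (Set.Icc (-1) 1) f)
      (fun f h => ConcaveOn.add) (concaveOn_const 0 (convex_Icc _ _)) fun i hi => ?_
    exact (concaveOn_exp_mul_sub_sq (hgle i hi)).smul
      (mul_nonneg (hw i hi) (Real.exp_pos _).le)
  have hTeq : ∀ δ, ∑ i ∈ s, (w i * Real.exp (δ * g i)) *
      Real.exp (walkPotential V (b p) (x p + δ) (θ i)) = T (x p + δ) := by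
    intro δ
    refine Finset.sum_congr rfl fun i _ => ?_
    rw [hC]
    simp only [mul_assoc, ← Real.exp_add]
    congr 2
    simp only [walkPotential, hg, hr]
    ring
  have move : ∀ δ : ℝ, (∀ k ∈ insert p A, |x k + δ * u k| ≤ 1) →
      (∃ k ∈ insert p A, |x k + δ * u k| = 1) → T (x p + δ) ≤ T (x p) →
      ∃ ε : ι → ℝ, (∀ k, |ε k| = 1) ∧ (∀ k, |x k| = 1 → ε k = x k) ∧
      ∑ i ∈ s, w i * Real.exp (inner ℝ (θ i) (∑ k, (ε k - x k) • b k)) ≤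
        ∑ i ∈ s, w i * Real.exp (walkPotential V (b p) (x p) (θ i)) := by
    intro δ h1 h2 h3
    have hout : ∀ k, k ∉ insert p A → x k + δ * u k = x k := fun k hk => by simp [hu0 k hk]
    obtain ⟨ε, e1, e2, e3⟩ := frozen (fun i => w i * Real.exp (δ * g i)) (fun k => x k + δ * u k)
      (fun i hi => mul_nonneg (hw i hi) (Real.exp_pos _).le)
      (fun k => by
        by_cases hk : k ∈ insert p A
        · exact h1 k hk
        · simpa only [hout k hk] using hx k)
      (fun k hk hkp => by
        have hk' : k ∉ insert p A := by simp [hk, hkp]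
        simpa only [hout k hk'] using hfix k hk hkp) h2
    refine ⟨ε, e1, fun k hk => ?_, ?_⟩
    · have hk' : k ∉ insert p A := fun h => hal k h hk
      have := e2 k (by simpa only [hout k hk'] using hk)
      simpa only [hout k hk'] using this
    · have hl : ∑ i ∈ s, w i * Real.exp (inner ℝ (θ i) (∑ k, (ε k - x k) • b k))
          = ∑ i ∈ s, (w i * Real.exp (δ * g i)) *
            Real.exp (inner ℝ (θ i) (∑ k, (ε k - (x k + δ * u k)) • b k)) := by
        refine Finset.sum_congr rfl fun i _ => ?_
        rw [mul_assoc, ← Real.exp_add]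
        congr 2
        have : ∑ k, (ε k - x k) • b k
            = δ • r + ∑ k, (ε k - (x k + δ * u k)) • b k := by
          rw [← hur, Finset.smul_sum, ← Finset.sum_add_distrib]
          refine Finset.sum_congr rfl fun k _ => ?_
          module
        rw [this, inner_add_right, inner_smul_right]
      rw [hl]
      refine e3.trans ?_
      have h4 := hTeq 0
      simp only [zero_mul, Real.exp_zero, mul_one, add_zero] at h4
      rw [h4, hup, mul_one, hTeq δ]
      exact h3
  obtain ⟨δ₁, hδ₁, ha₁, hb₁⟩ := exists_step_to_boundary (insert p A) x u hlt
    (Finset.mem_insert_self p A) (by rw [hup]; exact one_ne_zero)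
  obtain ⟨δ₂, hδ₂, ha₂, hb₂⟩ := exists_step_to_boundary (insert p A) x (fun k => - u k) hlt
    (Finset.mem_insert_self p A) (by rw [hup]; norm_num)
  have ha₂' : ∀ k ∈ insert p A, |x k + -δ₂ * u k| ≤ 1 := fun k hk => by
    simpa using ha₂ k hk
  have hb₂' : ∃ k ∈ insert p A, |x k + -δ₂ * u k| = 1 := by simpa using hb₂
  have m₁ : x p + δ₁ ∈ Set.Icc (-1 : ℝ) 1 := by
    have := ha₁ p (Finset.mem_insert_self p A)
    rw [hup, mul_one] at this
    exact abs_le.1 this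
  have m₂ : x p + -δ₂ ∈ Set.Icc (-1 : ℝ) 1 := by
    have := ha₂' p (Finset.mem_insert_self p A)
    rw [hup, mul_one] at this
    exact abs_le.1 this
  -- `x p` lies between the two stopping values, so by concavity one of them does not increase `T`.
  have hmin := hTconc.min_le_of_mem_Icc m₂ m₁
    (z := x p) ⟨by linarith, by linarith⟩
  rcases min_le_iff.1 hmin with h | h
  · exact move (-δ₂) ha₂' hb₂' h
  · exact move δ₁ ha₁ hb₁ h

/-- Rounding a point of the cube to a vertex with logarithmic discrepancy (Komlós setting). -/
theorem exists_rounding_abs_sum_le {ι J : Type*} [Fintype ι] [Fintype J] [Nonempty J]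
    (a : J → ι → ℝ) {lam : ℝ} (hlam : 0 < lam) (ha : ∀ k, ∑ j, a j k ^ 2 ≤ lam)
    (x : ι → ℝ) (hx : ∀ k, |x k| ≤ 1) :
    ∃ ε : ι → ℝ, (∀ k, |ε k| = 1) ∧ (∀ k, |x k| = 1 → ε k = x k) ∧
      ∀ j, |∑ k, (ε k - x k) * a j k| ≤
        5 * (Real.log (2 * Fintype.card J) + 1 / 25) * Real.sqrt lam := by
  classical
  rcases isEmpty_or_nonempty ι with hι | ⟨⟨p⟩⟩
  · refine ⟨x, fun k => isEmptyElim k, fun _ _ => rfl, fun j => ?_⟩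
    have h1 : (1 : ℝ) ≤ Fintype.card J := by exact_mod_cast Fintype.card_pos
    have h2 : 0 ≤ Real.log (2 * Fintype.card J) := Real.log_nonneg (by linarith)
    simp only [Finset.univ_eq_empty, Finset.sum_empty, abs_zero]
    positivity
  have hs : 0 < Real.sqrt lam := Real.sqrt_pos.2 hlam
  set b : ι → EuclideanSpace ℝ J := fun k => WithLp.toLp 2 fun j => a j k / Real.sqrt lam with hb
  have hb1 : ∀ k, ‖b k‖ ≤ 1 := by
    intro k
    rw [EuclideanSpace.norm_eq, Real.sqrt_le_one]
    simp only [hb, Real.norm_eq_abs, sq_abs, div_pow, Real.sq_sqrt hlam.le]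
    rw [← Finset.sum_div, div_le_one hlam]
    exact ha k
  -- Both signs of each basis vector, at the largest length the walk allows. Each initial potential
  -- is at most `‖θ i‖ ^ 2 = 1 / 25`, and bounding a single exponential by the whole sum yields the
  -- logarithm.
  set θ : J × Bool → EuclideanSpace ℝ J := fun i =>
    EuclideanSpace.single i.1 (cond i.2 (1 / 5) (-(1 / 5))) with hθ
  have hθn : ∀ i, ‖θ i‖ = 1 / 5 := by
    rintro ⟨j, _ | _⟩ <;> simp [hθ]
  obtain ⟨ε, h1, h2, h3⟩ := exists_rounding_sum_exp_le_walkPotential (Finset.univ) θ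
    (fun i _ => (hθn i).le) b hb1 _ (Finset.univ.erase p) p (fun _ => 1) x rfl (by simp)
    (fun _ _ => zero_le_one) hx (fun k hk hkp => absurd (by simp [hkp]) hk)
  refine ⟨ε, h1, h2, fun j => ?_⟩
  have hub : ∑ i : J × Bool, (1 : ℝ) * Real.exp (walkPotential
      (Submodule.span ℝ (b '' (Finset.univ.erase p : Finset ι))) (b p) (x p) (θ i))
      ≤ 2 * Fintype.card J * Real.exp (1 / 25) := by
    calc _ ≤ ∑ i : J × Bool, Real.exp (1 / 25) := by
          refine Finset.sum_le_sum fun i _ => ?_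
          rw [one_mul, Real.exp_le_exp]
          refine (walkPotential_le_norm_sq_starProjection (W := ⊤) le_top trivial _ _).trans ?_
          rw [Submodule.starProjection_top']
          simp only [one_apply_eq_self, hθn]
          norm_num
      _ = _ := by
          simp
          ring
  have hone : ∀ c : Bool, Real.exp (inner ℝ (θ (j, c)) (∑ k, (ε k - x k) • b k)) ≤
      2 * Fintype.card J * Real.exp (1 / 25) := by
    intro c
    refine le_trans ?_ (h3.trans hub)
    simp only [one_mul]
    exact Finset.single_le_sum (f := fun i => Real.exp (inner ℝ (θ i) (∑ k, (ε k - x k) • b k)))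
      (fun i _ => (Real.exp_pos _).le) (Finset.mem_univ (j, c))
  have hin : ∀ c : Bool, inner ℝ (θ (j, c)) (∑ k, (ε k - x k) • b k)
      = cond c (1 / 5) (-(1 / 5)) * ((∑ k, (ε k - x k) * a j k) / Real.sqrt lam) := by
    intro c
    rw [hθ]
    simp only [EuclideanSpace.inner_single_left, WithLp.ofLp_sum, Finset.sum_apply, hb,
      WithLp.ofLp_smul, Pi.smul_apply, smul_eq_mul, Finset.sum_div, mul_div_assoc]
    simp
  have hcard : (0 : ℝ) < 2 * Fintype.card J := by
    have : (0 : ℝ) < Fintype.card J := by exact_mod_cast Fintype.card_pos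
    linarith
  have hlog : ∀ c : Bool, cond c (1 / 5) (-(1 / 5)) * ((∑ k, (ε k - x k) * a j k) / Real.sqrt lam)
      ≤ Real.log (2 * Fintype.card J) + 1 / 25 := by
    intro c
    rw [← hin c, ← Real.log_exp (1 / 25), ← Real.log_mul hcard.ne' (Real.exp_pos _).ne',
      Real.le_log_iff_exp_le (by positivity)]
    exact hone c
  have ht := hlog true
  have hf := hlog false
  simp only [cond_true, cond_false] at ht hf
  have : |(∑ k, (ε k - x k) * a j k) / Real.sqrt lam|
      ≤ 5 * (Real.log (2 * Fintype.card J) + 1 / 25) := by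
    rw [abs_le]; constructor <;> linarith
  rwa [abs_div, abs_of_pos hs, div_le_iff₀ hs] at this

end VectorBalancing

/-! ### Bang's plank lemma. -/

section Plank

/-- The real number `±1` coded by a Boolean. -/
def boolSign (c : Bool) : ℝ := cond c 1 (-1)

lemma abs_boolSign (c : Bool) : |boolSign c| = 1 := by cases c <;> simp [boolSign]

lemma boolSign_not (c : Bool) : boolSign (!c) = -boolSign c := by cases c <;> simp [boolSign]

lemma boolSign_mul_self (c : Bool) : boolSign c * boolSign c = 1 := by cases c <;> simp [boolSign]

/-- Bang's lemma: a signed sum of the `u j` that is far from every given affine hyperplane with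
normal vector `u j`. -/
theorem exists_far_from_hyperplanes {ι J : Type*} [Fintype ι] [Fintype J]
    (u : J → ι → ℝ) (t : J → ℝ) {w : ℝ} (hw : 0 < w) :
    ∃ x : ι → ℝ, (∀ k, |x k| ≤ w * ∑ j, |u j k|) ∧
      ∀ j, w * ∑ k, u j k ^ 2 ≤ |∑ k, u j k * x k - t j| := by
  classical
  set P : (J → Bool) → ι → ℝ := fun e k => w * ∑ j, boolSign (e j) * u j k with hP
  -- Bang's functional. At a maximizing sign pattern, flipping the sign of `j` does not increase it,
  -- and this says exactly that `P e` is far from hyperplane `j`.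
  set f : (J → Bool) → ℝ := fun e => ∑ k, P e k ^ 2 - 2 * w * ∑ j, boolSign (e j) * t j with hf
  obtain ⟨e, -, hmax⟩ := Finset.exists_max_image (Finset.univ) f Finset.univ_nonempty
  refine ⟨P e, fun k => ?_, fun j => ?_⟩
  · rw [hP, abs_mul, abs_of_pos hw]
    refine mul_le_mul_of_nonneg_left ((Finset.abs_sum_le_sum_abs _ _).trans
      (Finset.sum_le_sum fun j _ => ?_)) hw.le
    rw [abs_mul, abs_boolSign, one_mul]
  · have hsum : ∀ h : J → ℝ, ∑ i, boolSign (Function.update e j (!e j) i) * h i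
        = ∑ i, boolSign (e i) * h i - 2 * boolSign (e j) * h j := by
      intro h
      rw [← Finset.add_sum_erase _ _ (Finset.mem_univ j),
        ← Finset.add_sum_erase _ (fun i => boolSign (e i) * h i) (Finset.mem_univ j)]
      have : ∑ i ∈ Finset.univ.erase j, boolSign (Function.update e j (!e j) i) * h i
          = ∑ i ∈ Finset.univ.erase j, boolSign (e i) * h i :=
        Finset.sum_congr rfl fun i hi => by
          rw [Function.update_of_ne (Finset.ne_of_mem_erase hi)]
      rw [this, Function.update_self, boolSign_not]
      ring
    have hPe : ∀ k, P (Function.update e j (!e j)) k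
        = P e k - 2 * w * boolSign (e j) * u j k := by
      intro k
      simp only [hP]
      rw [hsum]
      ring
    have hfe : f (Function.update e j (!e j)) = f e
        - 4 * w * boolSign (e j) * (∑ k, u j k * P e k - t j) + 4 * w * (w * ∑ k, u j k ^ 2) := by
      have h1 : ∑ k, P (Function.update e j (!e j)) k ^ 2 = ∑ k, P e k ^ 2
          - 4 * w * boolSign (e j) * ∑ k, u j k * P e k + 4 * w * (w * ∑ k, u j k ^ 2) := by
        rw [Finset.mul_sum, Finset.mul_sum, Finset.mul_sum, ← Finset.sum_sub_distrib,
          ← Finset.sum_add_distrib]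
        refine Finset.sum_congr rfl fun k _ => ?_
        rw [hPe]
        linear_combination 4 * w ^ 2 * u j k ^ 2 * boolSign_mul_self (e j)
      simp only [hf]
      rw [h1, hsum]
      ring
    have hle := hmax (Function.update e j (!e j)) (Finset.mem_univ _)
    rw [hfe] at hle
    have h2 : w * ∑ k, u j k ^ 2 ≤ boolSign (e j) * (∑ k, u j k * P e k - t j) := by
      have : 4 * w * (w * ∑ k, u j k ^ 2)
          ≤ 4 * w * (boolSign (e j) * (∑ k, u j k * P e k - t j)) := by linarith
      exact le_of_mul_le_mul_left this (by linarith)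
    refine h2.trans ((le_abs_self _).trans ?_)
    rw [abs_mul, abs_boolSign, one_mul]

end Plank

/-! ### Anticoncentration of a random vertex across scales. -/

section Anticoncentration

variable {ι : Type*} [Fintype ι]

/-- Distance from the vertex `X` to the hyperplane `⟪v, x⟫ = t` (for unnormalized `v`). -/
def signDist (v : ι → ℝ) (t : ℝ) (X : ι → Bool) : ℝ := |∑ k, v k * boolSign (X k) - t|

/-- The orders of magnitude, in base `q`, of the nonzero coordinates of `v`. -/
noncomputable def scales (q : ℕ) (v : ι → ℝ) : Finset ℤ :=
  ((Finset.univ : Finset ι).filter fun k => v k ≠ 0).image fun k => Int.log q |v k|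

lemma mem_scales {q : ℕ} {v : ι → ℝ} {i : ℤ} :
    i ∈ scales q v ↔ ∃ k, v k ≠ 0 ∧ Int.log q |v k| = i := by
  simp [scales]

variable [DecidableEq ι] {q : ℕ} (hq : 2 * Fintype.card ι ≤ q) (hq4 : 4 ≤ q)
include hq hq4

/-- At the largest scale `i` where the two vertices differ, the representative changes the linear
form by at least `2 * q ^ i`. The smaller representatives contribute at most `q ^ (i - 2)` in total,
by the gap of `4` and `2 * card ι ≤ q`, while closeness allows a total change of only `2 * q ^ (e +
2) ≤ 2 * q ^ (i - 2)`. -/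
lemma eq_of_signDist_le {v : ι → ℝ} {t : ℝ} {C : Finset ℤ} {rep : ℤ → ι} {e : ℤ}
    (hrep : ∀ i ∈ C, v (rep i) ≠ 0 ∧ Int.log q |v (rep i)| = i)
    (hgap : ∀ i ∈ C, ∀ j ∈ C, j < i → j + 4 ≤ i) (he : ∀ i ∈ C, e + 4 ≤ i)
    {X Y : ι → Bool} (hX : signDist v t X ≤ (q : ℝ) ^ (e + 2))
    (hY : signDist v t Y ≤ (q : ℝ) ^ (e + 2))
    (hXY : ∀ k, (∀ i ∈ C, rep i ≠ k) → X k = Y k) : X = Y := by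
  classical
  by_contra hne
  obtain ⟨k₀, hk₀⟩ := Function.ne_iff.1 hne
  have hDne : (C.filter fun i => X (rep i) ≠ Y (rep i)).Nonempty := by
    by_contra h
    rw [Finset.not_nonempty_iff_eq_empty, Finset.filter_eq_empty_iff] at h
    refine hk₀ (hXY k₀ fun i hi h' => ?_)
    subst h'
    exact h hi hk₀
  obtain ⟨i, hi, himax⟩ := Finset.exists_max_image _ id hDne
  rw [Finset.mem_filter] at hi
  have hq0 : (0 : ℝ) < q := by exact_mod_cast (by omega : 0 < q)
  have hq1 : (1 : ℝ) ≤ q := by exact_mod_cast (by omega : 1 ≤ q)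
  have hqR : (4 : ℝ) ≤ q := by exact_mod_cast hq4
  set c : ι → ℝ := fun k => v k * (boolSign (X k) - boolSign (Y k)) with hc
  have hctop : 2 * (q : ℝ) ^ i ≤ |c (rep i)| := by
    have h1 := Int.zpow_log_le_self (b := q) (r := |v (rep i)|) (by omega)
      (abs_pos.2 (hrep i hi.1).1)
    rw [(hrep i hi.1).2] at h1
    have h2 : |boolSign (X (rep i)) - boolSign (Y (rep i))| = 2 := by
      have := hi.2
      cases h3 : X (rep i) <;> cases h4 : Y (rep i) <;> simp_all [boolSign] <;> norm_num
    rw [hc]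
    simp only [abs_mul, h2]
    linarith
  have hcoth : ∀ k ∈ Finset.univ.erase (rep i), |c k| ≤ 2 * (q : ℝ) ^ (i - 3) := by
    intro k hk
    by_cases hXk : X k = Y k
    · simp only [hc, hXk, sub_self, mul_zero, abs_zero]; positivity
    have : ∃ i' ∈ C, rep i' = k := by
      by_contra! h
      exact hXk (hXY k h)
    obtain ⟨i', hi', rfl⟩ := this
    have hne' : i' ≠ i := fun h => Finset.ne_of_mem_erase hk (by rw [h])
    have hle : i' ≤ i := himax i' (by simp [hi', hXk])
    have h4 := hgap i hi.1 i' hi' (lt_of_le_of_ne hle hne')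
    have h1 := Int.lt_zpow_succ_log_self (b := q) (by omega) |v (rep i')|
    rw [(hrep i' hi').2] at h1
    have h2 : (q : ℝ) ^ (i' + 1) ≤ (q : ℝ) ^ (i - 3) := zpow_le_zpow_right₀ hq1 (by omega)
    have h3 : |boolSign (X (rep i')) - boolSign (Y (rep i'))| ≤ 2 := by
      refine (abs_sub _ _).trans ?_
      rw [abs_boolSign, abs_boolSign]; norm_num
    simp only [hc, abs_mul]
    nlinarith [abs_nonneg (v (rep i'))]
  have hsum : |∑ k, c k| ≤ 2 * (q : ℝ) ^ (e + 2) := by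
    have : ∑ k, c k = (∑ k, v k * boolSign (X k) - t) - (∑ k, v k * boolSign (Y k) - t) := by
      simp only [hc, mul_sub, Finset.sum_sub_distrib]; ring
    rw [this]
    refine (abs_sub _ _).trans ?_
    unfold signDist at hX hY
    linarith
  have hrest : |∑ k ∈ Finset.univ.erase (rep i), c k| ≤ (q : ℝ) ^ (i - 2) := by
    refine (Finset.abs_sum_le_sum_abs _ _).trans ((Finset.sum_le_card_nsmul _ _ _ hcoth).trans ?_)
    rw [nsmul_eq_mul]
    have h1 : ((Finset.univ.erase (rep i)).card : ℝ) ≤ Fintype.card ι := by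
      exact_mod_cast Finset.card_le_univ _
    have h2 : 2 * (Fintype.card ι : ℝ) ≤ q := by exact_mod_cast hq
    have h3 : (q : ℝ) ^ (i - 2) = q * (q : ℝ) ^ (i - 3) := by
      rw [show i - 2 = 1 + (i - 3) by ring, zpow_add₀ hq0.ne', zpow_one]
    rw [h3]
    have := zpow_pos hq0 (i - 3)
    nlinarith
  rw [← Finset.add_sum_erase _ _ (Finset.mem_univ (rep i))] at hsum
  have h5 : (q : ℝ) ^ (e + 2) ≤ (q : ℝ) ^ (i - 2) :=
    zpow_le_zpow_right₀ hq1 (by have := he i hi.1; omega)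
  have h6 : (q : ℝ) ^ i = q * q * (q : ℝ) ^ (i - 2) := by
    rw [show i = 1 + (1 + (i - 2)) by ring, zpow_add₀ hq0.ne', zpow_add₀ hq0.ne', zpow_one]
    ring_nf
  have h7 : |c (rep i)| ≤ |c (rep i) + ∑ k ∈ Finset.univ.erase (rep i), c k|
      + |∑ k ∈ Finset.univ.erase (rep i), c k| := by
    have := abs_sub (c (rep i) + ∑ k ∈ Finset.univ.erase (rep i), c k)
      (∑ k ∈ Finset.univ.erase (rep i), c k)
    rwa [add_sub_cancel_right] at this
  have h8 := zpow_pos hq0 (i - 2)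
  have h9 : 2 * (q : ℝ) ^ i ≤ 3 * (q : ℝ) ^ (i - 2) := by linarith
  rw [h6] at h9
  nlinarith [mul_pos h8 hq0]

/-- Once the other coordinates are fixed, at most one sign pattern on the representatives of `C` is
close. So overwriting those entries of a close vertex by an arbitrary subset of `C` is injective. -/
lemma card_signDist_le_mul_two_pow [Nonempty ι] (v : ι → ℝ) (t : ℝ) {C : Finset ℤ} {e : ℤ}
    (hC : C ⊆ scales q v) (hgap : ∀ i ∈ C, ∀ j ∈ C, j < i → j + 4 ≤ i)
    (he : ∀ i ∈ C, e + 4 ≤ i) :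
    (Finset.univ.filter fun X : ι → Bool => signDist v t X ≤ (q : ℝ) ^ (e + 2)).card * 2 ^ C.card
      ≤ 2 ^ Fintype.card ι := by
  classical
  have hex : ∀ i : ℤ, ∃ k : ι, i ∈ C → v k ≠ 0 ∧ Int.log q |v k| = i := by
    intro i
    by_cases hi : i ∈ C
    · obtain ⟨k, hk⟩ := mem_scales.1 (hC hi)
      exact ⟨k, fun _ => hk⟩
    · exact ⟨Classical.arbitrary ι, fun h => absurd h hi⟩
  choose rep hrep using hex
  rw [← Finset.card_powerset, ← Finset.card_product]
  have hcard : 2 ^ Fintype.card ι = (Finset.univ : Finset (ι → Bool)).card := by simp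
  rw [hcard]
  refine Finset.card_le_card_of_injOn
    (fun Z k => if k ∈ C.image rep then decide (Int.log q |v k| ∈ Z.2) else Z.1 k)
    (fun _ _ => Finset.mem_coe.2 (Finset.mem_univ _)) ?_
  rintro ⟨X, S⟩ hXS ⟨Y, T⟩ hYT h
  simp only [Finset.coe_product, Set.mem_prod, Finset.mem_coe, Finset.mem_filter,
    Finset.mem_univ, true_and, Finset.mem_powerset] at hXS hYT
  have h1 : X = Y := by
    refine eq_of_signDist_le hq hq4 (C := C) (rep := rep) hrep hgap he hXS.1 hYT.1 fun k hk => ?_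
    have hk' : k ∉ C.image rep := by
      simp only [Finset.mem_image, not_exists, not_and]
      exact hk
    have := congrFun h k
    simpa only [hk', if_false] using this
  have h2 : ∀ i ∈ C, (i ∈ S ↔ i ∈ T) := by
    intro i hi
    have := congrFun h (rep i)
    simpa only [Finset.mem_image_of_mem rep hi, if_true, (hrep i hi).2, decide_eq_decide]
      using this
  refine Prod.ext h1 (Finset.ext fun i => ⟨fun hi => (h2 i (hXS.2 hi)).1 hi,
    fun hi => (h2 i (hYT.2 hi)).2 hi⟩)

omit hq hq4 in
lemma sum_half_pow_card_filter_eq (C : Finset ℤ) :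
    ∑ i ∈ C, (1 / 2 : ℝ) ^ (C.filter fun j => i < j).card = 2 - 2 * (1 / 2) ^ C.card := by
  induction C using Finset.induction_on_min with
  | empty => simp
  | insert a s ha ih =>
    have has : a ∉ s := fun h => lt_irrefl _ (ha a h)
    rw [Finset.sum_insert has, Finset.card_insert_of_notMem has]
    have h1 : (insert a s).filter (fun j => a < j) = s := by
      rw [Finset.filter_insert, if_neg (lt_irrefl a), Finset.filter_true_of_mem ha]
    have h2 : ∀ i ∈ s, (1 / 2 : ℝ) ^ ((insert a s).filter fun j => i < j).card
        = (1 / 2 : ℝ) ^ (s.filter fun j => i < j).card := by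
      intro i hi
      rw [Finset.filter_insert, if_neg (not_lt.2 (ha i hi).le)]
    rw [h1, Finset.sum_congr rfl h2, ih]
    ring

/-- On average over the vertices `X`, the number of scales of `v` at which `X` is close to the
hyperplane is bounded. -/
lemma sum_card_filter_scales_le [Nonempty ι] (v : ι → ℝ) (t : ℝ) :
    ∑ X : ι → Bool, (((scales q v).filter fun i => signDist v t X ≤ (q : ℝ) ^ (i + 2)).card : ℝ)
      ≤ 8 * 2 ^ Fintype.card ι := by
  classical
  set N : ℤ → ℕ := fun i =>
    (Finset.univ.filter fun X : ι → Bool => signDist v t X ≤ (q : ℝ) ^ (i + 2)).card with hN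
  have h1 : ∑ X : ι → Bool,
      (((scales q v).filter fun i => signDist v t X ≤ (q : ℝ) ^ (i + 2)).card : ℝ)
      = ∑ i ∈ scales q v, (N i : ℝ) := by
    simp only [hN, Finset.card_filter]
    push_cast
    exact Finset.sum_comm
  -- Residue classes modulo `4` supply the required gaps. In each class the probability of closeness
  -- at `i` halves with every larger scale, so the class contributes at most `2`.
  have h2 : ∑ i ∈ scales q v, (N i : ℝ)
      = ∑ r ∈ Finset.range 4, ∑ i ∈ (scales q v).filter (fun i => (i % 4).toNat = r), (N i : ℝ) := by
    refine (Finset.sum_fiberwise_of_maps_to (fun i _ => ?_) _).symm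
    rw [Finset.mem_range]
    omega
  rw [h1, h2]
  have h3 : ∀ r ∈ Finset.range 4,
      ∑ i ∈ (scales q v).filter (fun i => (i % 4).toNat = r), (N i : ℝ)
        ≤ 2 * 2 ^ Fintype.card ι := by
    intro r _
    set C := (scales q v).filter (fun i => (i % 4).toNat = r) with hC
    have h4 : ∀ i ∈ C, (N i : ℝ)
        ≤ 2 ^ Fintype.card ι * (1 / 2 : ℝ) ^ (C.filter fun j => i < j).card := by
      intro i hi
      have hi' := (Finset.mem_filter.1 hi).2
      have := card_signDist_le_mul_two_pow hq hq4 v t (C := C.filter fun j => i < j) (e := i)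
        ((Finset.filter_subset _ _).trans (Finset.filter_subset _ _))
        (fun a ha b hb hab => by
          have ha' := (Finset.mem_filter.1 (Finset.mem_filter.1 ha).1).2
          have hb' := (Finset.mem_filter.1 (Finset.mem_filter.1 hb).1).2
          omega)
        (fun a ha => by
          have ha' := (Finset.mem_filter.1 (Finset.mem_filter.1 ha).1).2
          have hlt := (Finset.mem_filter.1 ha).2
          omega)
      have h5 : (N i : ℝ) * 2 ^ (C.filter fun j => i < j).card ≤ 2 ^ Fintype.card ι := by
        exact_mod_cast this
      rw [one_div, inv_pow, ← div_eq_mul_inv, le_div_iff₀ (by positivity)]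
      exact h5
    refine (Finset.sum_le_sum h4).trans ?_
    rw [← Finset.mul_sum, sum_half_pow_card_filter_eq]
    have : (0 : ℝ) < (1 / 2) ^ C.card := by positivity
    have : (0 : ℝ) < 2 ^ Fintype.card ι := by positivity
    nlinarith
  refine (Finset.sum_le_sum h3).trans ?_
  simp
  linarith

/-- A vertex that is close to the given hyperplanes at boundedly many scales on average. -/
lemma exists_vertex_sum_card_filter_scales_le [Nonempty ι] {J : Type*} [Fintype J] (v : J → ι → ℝ) (t : J → ℝ) :
    ∃ X : ι → Bool, ∑ j, (((scales q (v j)).filter fun i =>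
      signDist (v j) (t j) X ≤ (q : ℝ) ^ (i + 2)).card : ℝ) ≤ 8 * Fintype.card J := by
  have h : ∑ X : ι → Bool, ∑ j, (((scales q (v j)).filter fun i =>
      signDist (v j) (t j) X ≤ (q : ℝ) ^ (i + 2)).card : ℝ)
      ≤ ∑ _X : ι → Bool, (8 * Fintype.card J : ℝ) := by
    rw [Finset.sum_comm]
    refine (Finset.sum_le_sum fun j _ => sum_card_filter_scales_le hq hq4 (v j) (t j)).trans ?_
    simp
    linarith
  obtain ⟨X, -, hX⟩ := Finset.exists_le_of_sum_le Finset.univ_nonempty h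
  exact ⟨X, hX⟩

end Anticoncentration

/-! ### Energy argument selecting the subcube. -/

section Selection

variable {ι : Type*}

/-- The part of `v` on `G` of scale at most `i`, measured logarithmically in units of `q ^ i`. -/
noncomputable def scaleEnergy (q : ℕ) (v : ι → ℝ) (i : ℤ) (G : Finset ι) : ℝ :=
  Real.log (1 + (∑ k ∈ G, if |v k| < (q : ℝ) ^ (i + 1) then v k ^ 2 else 0) / ((q : ℝ) ^ i) ^ 2)

lemma scaleEnergy_arg_nonneg (q : ℕ) (v : ι → ℝ) (i : ℤ) (G : Finset ι) :
    0 ≤ (∑ k ∈ G, if |v k| < (q : ℝ) ^ (i + 1) then v k ^ 2 else 0) / ((q : ℝ) ^ i) ^ 2 :=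
  div_nonneg (Finset.sum_nonneg fun k _ => by split_ifs <;> positivity) (sq_nonneg _)

lemma scaleEnergy_nonneg (q : ℕ) (v : ι → ℝ) (i : ℤ) (G : Finset ι) : 0 ≤ scaleEnergy q v i G :=
  Real.log_nonneg (by linarith [scaleEnergy_arg_nonneg q v i G])

lemma scaleEnergy_mono (q : ℕ) (v : ι → ℝ) (i : ℤ) {G H : Finset ι} (h : G ⊆ H) :
    scaleEnergy q v i G ≤ scaleEnergy q v i H := by
  refine Real.log_le_log (by linarith [scaleEnergy_arg_nonneg q v i G]) ?_
  gcongr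

lemma scaleEnergy_le [Fintype ι] {q : ℕ} (hq : 0 < q) (v : ι → ℝ) (i : ℤ) (G : Finset ι) :
    scaleEnergy q v i G ≤ Real.log (1 + Fintype.card ι * (q : ℝ) ^ 2) := by
  have hq0 : (0 : ℝ) < q := by exact_mod_cast hq
  refine Real.log_le_log (by linarith [scaleEnergy_arg_nonneg q v i G]) ?_
  have hpos : 0 < (q : ℝ) ^ i := zpow_pos hq0 i
  rw [add_le_add_iff_left, div_le_iff₀ (by positivity)]
  have h1 : ∀ k ∈ G, (if |v k| < (q : ℝ) ^ (i + 1) then v k ^ 2 else 0)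
      ≤ (q : ℝ) ^ 2 * ((q : ℝ) ^ i) ^ 2 := by
    intro k _
    split_ifs with h
    · rw [← mul_pow, ← sq_abs]
      refine pow_le_pow_left₀ (abs_nonneg _) (h.le.trans_eq ?_) 2
      rw [zpow_add₀ hq0.ne', zpow_one, mul_comm]
    · positivity
  refine (Finset.sum_le_card_nsmul _ _ _ h1).trans ?_
  rw [nsmul_eq_mul, mul_assoc]
  gcongr
  exact Finset.card_le_univ G

variable [DecidableEq ι]

/-- At the top scale of `v` on `G` the truncation removes nothing, and its unit `Q` is at most the
full square sum `S`. Then `log x ≥ 1 - 1 / x` bounds the loss below by `v k ^ 2 / (Q + S)`. -/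
lemma le_scaleEnergy_sub_erase {q : ℕ} (hq : 1 < q) {v : ι → ℝ} {G : Finset ι} {k : ι} (hk : k ∈ G)
    {l : ι} (hl : l ∈ G) (hvl : v l ≠ 0)
    (hmax : ∀ k ∈ G, v k ≠ 0 → Int.log q |v k| ≤ Int.log q |v l|) :
    v k ^ 2 / (2 * ∑ k ∈ G, v k ^ 2) ≤
      scaleEnergy q v (Int.log q |v l|) G - scaleEnergy q v (Int.log q |v l|) (G.erase k) := by
  have hq0 : (0 : ℝ) < q := by exact_mod_cast (by omega : 0 < q)
  have hq1 : (1 : ℝ) ≤ q := by exact_mod_cast hq.le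
  set e := Int.log q |v l| with he
  set Q := ((q : ℝ) ^ e) ^ 2 with hQ
  have hQpos : 0 < Q := by positivity
  have hall : ∀ H ⊆ G, (∑ k ∈ H, if |v k| < (q : ℝ) ^ (e + 1) then v k ^ 2 else 0)
      = ∑ k ∈ H, v k ^ 2 := by
    intro H hH
    refine Finset.sum_congr rfl fun k hk => ?_
    by_cases h0 : v k = 0
    · simp [h0]
    rw [if_pos]
    exact (Int.lt_zpow_succ_log_self hq _).trans_le
      (zpow_le_zpow_right₀ hq1 (by have := hmax k (hH hk) h0; omega))
  set S := ∑ k ∈ G, v k ^ 2 with hS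
  have hSQ : Q ≤ S := by
    have h1 : (q : ℝ) ^ e ≤ |v l| := Int.zpow_log_le_self hq (abs_pos.2 hvl)
    have h2 : Q ≤ v l ^ 2 := by
      rw [← sq_abs]
      exact pow_le_pow_left₀ (zpow_pos hq0 e).le h1 2
    exact h2.trans (Finset.single_le_sum (f := fun k => v k ^ 2) (fun k _ => sq_nonneg _) hl)
  have hSk : ∑ k ∈ G.erase k, v k ^ 2 = S - v k ^ 2 := by
    rw [hS, ← Finset.add_sum_erase _ _ hk]; ring
  have hSk0 : 0 ≤ S - v k ^ 2 := by rw [← hSk]; positivity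
  unfold scaleEnergy
  rw [hall G le_rfl, hall _ (G.erase_subset k), ← hS, hSk, ← hQ]
  have hA : 0 < 1 + S / Q := by have := hQpos.trans_le hSQ; positivity
  have hB : 0 < 1 + (S - v k ^ 2) / Q := by
    have := div_nonneg hSk0 hQpos.le
    linarith
  rw [← Real.log_div hA.ne' hB.ne']
  refine le_trans ?_ (Real.one_sub_inv_le_log_of_pos (div_pos hA hB))
  have hSpos := hQpos.trans_le hSQ
  have e1 : 1 - ((1 + S / Q) / (1 + (S - v k ^ 2) / Q))⁻¹ = v k ^ 2 / (Q + S) := by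
    rw [inv_div]
    field_simp
    ring
  rw [e1]
  exact div_le_div_of_nonneg_left (sq_nonneg _) (by linarith) (by linarith)

variable [Fintype ι]

/-- The total energy of `v` on `G` over the scales at which the vertex `X` is close. -/
noncomputable def closeEnergy (q : ℕ) (v : ι → ℝ) (t : ℝ) (X : ι → Bool) (G : Finset ι) : ℝ :=
  ∑ i ∈ (scales q v).filter (fun i => signDist v t X ≤ (q : ℝ) ^ (i + 2)), scaleEnergy q v i G

/-- For an active hyperplane the top scale `e` on `G` is a close one, because `2 * ∑ l ∈ G, |v l| ≤
q * q ^ (e + 1)`. The drop at that scale suffices, as the other scales cannot gain energy. -/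
lemma le_closeEnergy_sub_erase {q : ℕ} (hq : 2 * Fintype.card ι ≤ q) (hq1 : 1 < q) (v : ι → ℝ)
    (t : ℝ) (X : ι → Bool) {G : Finset ι} {k : ι} (hk : k ∈ G) :
    (if signDist v t X ≤ 2 * ∑ l ∈ G, |v l| then v k ^ 2 / (2 * ∑ l ∈ G, v l ^ 2) else 0) ≤
      closeEnergy q v t X G - closeEnergy q v t X (G.erase k) := by
  have hnn : ∀ i, 0 ≤ scaleEnergy q v i G - scaleEnergy q v i (G.erase k) := fun i =>
    sub_nonneg.2 (scaleEnergy_mono q v i (G.erase_subset k))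
  unfold closeEnergy
  rw [← Finset.sum_sub_distrib]
  split_ifs with hd
  swap
  · exact Finset.sum_nonneg fun i _ => hnn i
  rcases (G.filter fun l => v l ≠ 0).eq_empty_or_nonempty with hemp | hne
  · have : v k = 0 := by
      by_contra h
      exact Finset.notMem_empty k (hemp ▸ Finset.mem_filter.2 ⟨hk, h⟩)
    rw [this]
    simp only [ne_eq, OfNat.ofNat_ne_zero, not_false_eq_true, zero_pow, zero_div]
    exact Finset.sum_nonneg fun i _ => hnn i
  obtain ⟨l, hl, hmax⟩ := Finset.exists_max_image _ (fun l => Int.log q |v l|) hne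
  rw [Finset.mem_filter] at hl
  have hmax' : ∀ k ∈ G, v k ≠ 0 → Int.log q |v k| ≤ Int.log q |v l| := fun k hk h0 =>
    hmax k (Finset.mem_filter.2 ⟨hk, h0⟩)
  refine (le_scaleEnergy_sub_erase hq1 hk hl.1 hl.2 hmax').trans
    (Finset.single_le_sum (f := fun i => scaleEnergy q v i G - scaleEnergy q v i (G.erase k))
      (fun i _ => hnn i) (Finset.mem_filter.2 ⟨mem_scales.2 ⟨l, hl.2, rfl⟩, hd.trans ?_⟩))
  have hq0 : (0 : ℝ) < q := by exact_mod_cast (by omega : 0 < q)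
  have hq1' : (1 : ℝ) ≤ q := by exact_mod_cast hq1.le
  set e := Int.log q |v l|
  have h1 : ∀ k ∈ G, |v k| ≤ (q : ℝ) ^ (e + 1) := by
    intro k hk
    by_cases h0 : v k = 0
    · rw [h0, abs_zero]; positivity
    exact (Int.lt_zpow_succ_log_self hq1 _).le.trans
      (zpow_le_zpow_right₀ hq1' (by have := hmax' k hk h0; omega))
  have h2 := Finset.sum_le_card_nsmul _ _ _ h1
  rw [nsmul_eq_mul] at h2
  have h3 : (G.card : ℝ) ≤ Fintype.card ι := by exact_mod_cast Finset.card_le_univ G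
  have h4 : 2 * (Fintype.card ι : ℝ) ≤ q := by exact_mod_cast hq
  have h5 : (q : ℝ) ^ (e + 2) = q * (q : ℝ) ^ (e + 1) := by
    rw [show e + 2 = 1 + (e + 1) by ring, zpow_add₀ hq0.ne', zpow_one]
  have h6 := zpow_pos hq0 (e + 1)
  rw [h5]
  nlinarith

/-- There is a vertex `X` and a nonempty set `G` of coordinates such that, for the hyperplanes that
are not far from the subcube through `X` in the directions `G`, the normalized restrictions of the
normal vectors to `G` are uniformly spread over the coordinates. -/
theorem exists_vertex_exists_spread_coordinates {J : Type*} [Fintype J] [Nonempty J] {n : ℕ}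
    (hn : 2 ≤ n) (hcard : Fintype.card ι = n) (v : J → ι → ℝ) (t : J → ℝ) :
    ∃ (X : ι → Bool) (G : Finset ι), G.Nonempty ∧ ∀ k ∈ G,
      ∑ j, (if signDist (v j) (t j) X ≤ 2 * ∑ l ∈ G, |v j l| then
        v j k ^ 2 / ∑ l ∈ G, v j l ^ 2 else 0) ≤
        32 * Fintype.card J * Real.log (1 + n * (2 * n : ℝ) ^ 2) / n := by
  have : Nonempty ι := Fintype.card_pos_iff.1 (by omega)
  have hq : 2 * Fintype.card ι ≤ 2 * n := by omega
  obtain ⟨X, hX⟩ := exists_vertex_sum_card_filter_scales_le hq (by omega) v t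
  have hn0 : (0 : ℝ) < n := by exact_mod_cast (by omega : 0 < n)
  have hm0 : (0 : ℝ) < Fintype.card J := by exact_mod_cast Fintype.card_pos
  set M := Real.log (1 + n * (2 * n : ℝ) ^ 2) with hM
  have hMpos : 0 < M := Real.log_pos (by
    have : 0 < (n : ℝ) * (2 * n) ^ 2 := by positivity
    linarith)
  -- Twice the average energy per coordinate allowed by `hΨle`: the full set then beats the empty
  -- one, so the minimizer is nonempty, while its minimality bounds the loss from each deletion by
  -- `c`.
  set c := 16 * Fintype.card J * M / n with hc
  have hcpos : 0 < c := by positivity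
  set Ψ : Finset ι → ℝ := fun G => ∑ j, closeEnergy (2 * n) (v j) (t j) X G with hΨ
  have hΨ0 : ∀ G, 0 ≤ Ψ G := fun G => Finset.sum_nonneg fun j _ => Finset.sum_nonneg fun i _ =>
    scaleEnergy_nonneg _ _ _ _
  have hΨle : Ψ Finset.univ ≤ 8 * Fintype.card J * M := by
    calc Ψ Finset.univ ≤ ∑ j, (((scales (2 * n) (v j)).filter fun i =>
          signDist (v j) (t j) X ≤ ((2 * n : ℕ) : ℝ) ^ (i + 2)).card : ℝ) * M := by
          refine Finset.sum_le_sum fun j _ => ?_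
          rw [← nsmul_eq_mul]
          refine Finset.sum_le_card_nsmul _ _ _ fun i _ => ?_
          have := scaleEnergy_le (by omega : 0 < 2 * n) (v j) i (Finset.univ : Finset ι)
          rw [hcard] at this
          push_cast at this
          exact this
      _ ≤ _ := by
          rw [← Finset.sum_mul]
          exact mul_le_mul_of_nonneg_right hX hMpos.le
  obtain ⟨G, -, hG⟩ := Finset.exists_min_image (Finset.univ : Finset (Finset ι))
    (fun G => Ψ G - c * G.card) Finset.univ_nonempty
  refine ⟨X, G, ?_, fun k hk => ?_⟩
  · by_contra h
    rw [Finset.not_nonempty_iff_eq_empty] at h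
    have h1 := hG Finset.univ (Finset.mem_univ _)
    have h2 := hΨ0 G
    rw [h] at h1 h2
    simp only [Finset.card_empty, Finset.card_univ, hcard, hc] at h1
    have h3 : 16 * (Fintype.card J : ℝ) * M / n * n = 16 * Fintype.card J * M := by field_simp
    have : 0 < (Fintype.card J : ℝ) * M := by positivity
    push_cast at h1
    linarith
  · have h1 := hG (G.erase k) (Finset.mem_univ _)
    rw [Finset.card_erase_of_mem hk, Nat.cast_sub (Finset.card_pos.2 ⟨k, hk⟩)] at h1
    push_cast at h1
    have h2 : Ψ G - Ψ (G.erase k) ≤ c := by linarith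
    rw [hΨ] at h2
    simp only [] at h2
    rw [← Finset.sum_sub_distrib] at h2
    have h3 := (Finset.sum_le_sum fun j (_ : j ∈ Finset.univ) =>
      le_closeEnergy_sub_erase hq (by omega) (v j) (t j) X hk).trans h2
    have h4 : ∑ j, (if signDist (v j) (t j) X ≤ 2 * ∑ l ∈ G, |v j l| then
        v j k ^ 2 / ∑ l ∈ G, v j l ^ 2 else 0)
        = 2 * ∑ j, (if signDist (v j) (t j) X ≤ 2 * ∑ l ∈ G, |v j l| then
        v j k ^ 2 / (2 * ∑ l ∈ G, v j l ^ 2) else 0) := by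
      rw [Finset.mul_sum]
      refine Finset.sum_congr rfl fun j _ => ?_
      split_ifs
      · rw [mul_comm 2 (∑ l ∈ G, v j l ^ 2), ← div_div]; ring
      · simp
    rw [h4]
    calc _ ≤ 2 * c := by linarith
      _ = _ := by rw [hc]; ring

end Selection

/-! ### An edge separated by no hyperplane. -/

section Edge

lemma mul_nonneg_of_abs_sub_lt {y y' z : ℝ} (h : |y - z| < |z|) (h' : |y' - z| < |z|) :
    0 ≤ y * y' := by
  rcases le_or_gt 0 z with hz | hz
  · rw [abs_of_nonneg hz, abs_lt] at h h'
    exact mul_nonneg (by linarith) (by linarith)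
  · rw [abs_of_neg hz, abs_lt] at h h'
    exact mul_nonneg_of_nonpos_of_nonpos (by linarith) (by linarith)

lemma mul_sub_nonneg_of_abs_le {a d : ℝ} (h : |d| ≤ |a|) : 0 ≤ a * (a - d) := by
  have h1 : a * d ≤ |a| * |a| :=
    (le_abs_self _).trans ((abs_mul a d).le.trans (mul_le_mul_of_nonneg_left h (abs_nonneg a)))
  rw [abs_mul_abs_self] at h1
  linarith [mul_sub a a d]

variable {ι : Type*} [Fintype ι] [DecidableEq ι]

/-- If there are few hyperplanes `∑ k, v j k * x k = t j`, then some edge of the cube (through the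
vertex `ε` in direction `k`) has no two endpoints strictly on different sides of any of them. -/
theorem exists_edge_not_separated {J : Type*} [Fintype J] [Nonempty J] {n : ℕ}
    (hn : 2 ≤ n) (hcard : Fintype.card ι = n) (v : J → ι → ℝ) (t : J → ℝ) {lam : ℝ}
    (hlam : lam = 32 * Fintype.card J * Real.log (1 + n * (2 * n : ℝ) ^ 2) / n)
    (hsmall : (5 * (Real.log (2 * Fintype.card J) + 1 / 25) + 2) * lam *
      Real.sqrt (Fintype.card J) ≤ 1) :
    ∃ (ε : ι → ℝ) (k : ι), (∀ k, |ε k| = 1) ∧ ∀ j,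
      0 ≤ (∑ l, v j l * ε l - t j) * (∑ l, v j l * ε l - t j - 2 * (v j k * ε k)) := by
  obtain ⟨X, G, ⟨k, hk⟩, hG⟩ := exists_vertex_exists_spread_coordinates hn hcard v t
  rw [← hlam] at hG
  have hn0 : (0 : ℝ) < n := by exact_mod_cast (by omega : 0 < n)
  have hm0 : (0 : ℝ) < Fintype.card J := by exact_mod_cast Fintype.card_pos
  set m : ℝ := (Fintype.card J : ℝ) with hm
  have hlam0 : 0 < lam := by
    have : 0 < Real.log (1 + n * (2 * n : ℝ) ^ 2) := Real.log_pos (by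
      have : 0 < (n : ℝ) * (2 * n) ^ 2 := by positivity
      linarith)
    rw [hlam]; positivity
  set S : J → ℝ := fun j => ∑ l ∈ G, v j l ^ 2 with hS
  have hS0 : ∀ j, 0 ≤ S j := fun j => Finset.sum_nonneg fun l _ => sq_nonneg _
  -- Inactive hyperplanes get the zero vector, so the column bound holds for all of `J` and Bang's
  -- lemma and the rounding need no subfamily.
  set u : J → ι → ℝ := fun j l =>
    if signDist (v j) (t j) X ≤ 2 * ∑ l ∈ G, |v j l| ∧ l ∈ G then v j l / Real.sqrt (S j) else 0
    with hu
  have huG : ∀ j l, l ∉ G → u j l = 0 := fun j l hl => by simp [hu, hl]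
  have hucol : ∀ l, ∑ j, u j l ^ 2 ≤ lam := by
    intro l
    by_cases hl : l ∈ G
    · refine le_trans (le_of_eq (Finset.sum_congr rfl fun j _ => ?_)) (hG l hl)
      simp only [hu, hl, and_true]
      split_ifs
      · rw [div_pow, Real.sq_sqrt (hS0 j)]
      · simp
    · simp [huG _ l hl, hlam0.le]
  -- The width for which Cauchy–Schwarz on the columns still keeps Bang's point inside the cube.
  set w : ℝ := 1 / (Real.sqrt m * Real.sqrt lam) with hw
  have hsm : 0 < Real.sqrt m := Real.sqrt_pos.2 hm0
  have hsl : 0 < Real.sqrt lam := Real.sqrt_pos.2 hlam0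
  have hwpos : 0 < w := by positivity
  obtain ⟨x₀, hx₀, hfar⟩ := exists_far_from_hyperplanes u
    (fun j => (t j - ∑ l ∈ Gᶜ, v j l * boolSign (X l)) / Real.sqrt (S j)) hwpos
  have hx₀1 : ∀ l, |x₀ l| ≤ 1 := by
    intro l
    refine (hx₀ l).trans ?_
    have h1 : (∑ j, |u j l|) ^ 2 ≤ m * lam := by
      have := sq_sum_le_card_mul_sum_sq (s := (Finset.univ : Finset J)) (f := fun j => |u j l|)
      simp only [sq_abs, Finset.card_univ] at this
      exact this.trans (mul_le_mul_of_nonneg_left (hucol l) hm0.le)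
    have h2 : ∑ j, |u j l| ≤ Real.sqrt m * Real.sqrt lam := by
      rw [← Real.sqrt_mul hm0.le]
      exact Real.le_sqrt_of_sq_le h1
    calc w * ∑ j, |u j l| ≤ w * (Real.sqrt m * Real.sqrt lam) :=
          mul_le_mul_of_nonneg_left h2 hwpos.le
      _ = 1 := by rw [hw]; field_simp
  -- Off `G` the starting point already has entries `±1`, which rounding preserves; hence `ε` stays
  -- in the subcube through `X`.
  obtain ⟨ε, hε1, hεfix, hround⟩ := exists_rounding_abs_sum_le u hlam0 hucol
    (fun l => if l ∈ G then x₀ l else boolSign (X l)) (fun l => by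
      split_ifs
      · exact hx₀1 l
      · exact (abs_boolSign _).le)
  have hεX : ∀ l, l ∉ G → ε l = boolSign (X l) := by
    intro l hl
    have := hεfix l (by simp [hl, abs_boolSign])
    simpa [hl] using this
  set D := 5 * (Real.log (2 * m) + 1 / 25) with hD
  -- The width covers the rounding error and leaves `2 * √lam`, enough for one edge since every `|u
  -- j k|` is at most `√lam`.
  have hwD : D * Real.sqrt lam + 2 * Real.sqrt lam ≤ w := by
    rw [hw, le_div_iff₀ (by positivity)]
    calc (D * Real.sqrt lam + 2 * Real.sqrt lam) * (Real.sqrt m * Real.sqrt lam)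
        = (D + 2) * (Real.sqrt lam * Real.sqrt lam) * Real.sqrt m := by ring
      _ ≤ 1 := by rw [Real.mul_self_sqrt hlam0.le]; exact hsmall
  refine ⟨ε, k, hε1, fun j => ?_⟩
  by_cases hact : signDist (v j) (t j) X ≤ 2 * ∑ l ∈ G, |v j l|
  · rcases (hS0 j).eq_or_lt with h0 | hSpos
    · have hv : v j k = 0 := by
        have := (Finset.sum_eq_zero_iff_of_nonneg (fun l _ => sq_nonneg (v j l))).1 h0.symm k hk
        exact pow_eq_zero_iff two_ne_zero |>.1 this
      rw [hv, zero_mul, mul_zero, sub_zero]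
      exact mul_self_nonneg _
    have hsS : 0 < Real.sqrt (S j) := Real.sqrt_pos.2 hSpos
    have huv : ∀ l ∈ G, u j l = v j l / Real.sqrt (S j) := fun l hl => by
      simp only [hu, hact, hl, and_self, if_true]
    have hunit : ∑ l, u j l ^ 2 = 1 := by
      rw [← Finset.sum_subset (Finset.subset_univ G) (fun l _ hl => by rw [huG j l hl]; simp)]
      rw [Finset.sum_congr rfl fun l hl => by rw [huv l hl, div_pow, Real.sq_sqrt (hS0 j)],
        ← Finset.sum_div]
      exact div_self hSpos.ne'
    have hfj := hfar j
    rw [hunit, mul_one] at hfj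
    set t' := (t j - ∑ l ∈ Gᶜ, v j l * boolSign (X l)) / Real.sqrt (S j) with ht'
    set a := ∑ l, u j l * ε l - t' with ha
    have hsplit : a = (∑ l, u j l * x₀ l - t') +
        ∑ l, (ε l - if l ∈ G then x₀ l else boolSign (X l)) * u j l := by
      have : ∑ l, (ε l - if l ∈ G then x₀ l else boolSign (X l)) * u j l
          = ∑ l, u j l * ε l - ∑ l, u j l * x₀ l := by
        rw [← Finset.sum_sub_distrib]
        refine Finset.sum_congr rfl fun l _ => ?_
        by_cases hl : l ∈ G
        · simp only [hl, if_true]; ring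
        · rw [huG j l hl]; ring
      rw [this, ha]; ring
    have ha2 : 2 * Real.sqrt lam ≤ |a| := by
      have h1 := hround j
      have h2 : |∑ l, u j l * x₀ l - t'| ≤ |a| +
          |∑ l, (ε l - if l ∈ G then x₀ l else boolSign (X l)) * u j l| := by
        have : ∑ l, u j l * x₀ l - t' = a -
            ∑ l, (ε l - if l ∈ G then x₀ l else boolSign (X l)) * u j l := by
          rw [hsplit]; ring
        rw [this]
        exact abs_sub _ _
      linarith
    have huk : |u j k| ≤ Real.sqrt lam := by
      refine Real.abs_le_sqrt (le_trans ?_ (hucol k))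
      exact Finset.single_le_sum (f := fun j => u j k ^ 2) (fun j _ => sq_nonneg _)
        (Finset.mem_univ j)
    have hval : ∑ l, v j l * ε l - t j = Real.sqrt (S j) * a := by
      have h1 : ∑ l, u j l * ε l = (∑ l ∈ G, v j l * ε l) / Real.sqrt (S j) := by
        rw [← Finset.sum_subset (Finset.subset_univ G) (fun l _ hl => by rw [huG j l hl]; simp),
          Finset.sum_div]
        exact Finset.sum_congr rfl fun l hl => by rw [huv l hl]; ring
      rw [ha, h1, ht', ← Finset.sum_add_sum_compl G,
        Finset.sum_congr rfl fun l (hl : l ∈ Gᶜ) => by rw [hεX l (Finset.mem_compl.1 hl)]]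
      field_simp
      ring
    have hvk : v j k = Real.sqrt (S j) * u j k := by
      rw [huv k hk]; field_simp
    have e : (∑ l, v j l * ε l - t j) * (∑ l, v j l * ε l - t j - 2 * (v j k * ε k))
        = S j * (a * (a - 2 * (u j k * ε k))) := by
      rw [hval, hvk]
      linear_combination (a * (a - 2 * (u j k * ε k))) * Real.mul_self_sqrt (hS0 j)
    rw [e]
    refine mul_nonneg (hS0 j) (mul_sub_nonneg_of_abs_le ?_)
    rw [abs_mul, abs_mul, hε1, abs_two, mul_one]
    linarith
  -- Inactive case: moving within the subcube changes the form by at most `2 * ∑ l ∈ G, |v j l|`,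
  -- less than its absolute value at `X`, so both endpoints lie on the side of `X`.
  · have hclose : ∀ y : ι → ℝ, (∀ l, |y l| = 1) → (∀ l, l ∉ G → y l = boolSign (X l)) →
        |(∑ l, v j l * y l - t j) - (∑ l, v j l * boolSign (X l) - t j)|
          < |∑ l, v j l * boolSign (X l) - t j| := by
      intro y hy hyX
      refine lt_of_le_of_lt ?_ (not_le.1 hact)
      have : (∑ l, v j l * y l - t j) - (∑ l, v j l * boolSign (X l) - t j)
          = ∑ l ∈ G, v j l * (y l - boolSign (X l)) := by
        rw [Finset.sum_subset (Finset.subset_univ G)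
          (fun l _ hl => by rw [hyX l hl]; ring)]
        simp only [mul_sub, Finset.sum_sub_distrib]
        ring
      rw [this, Finset.mul_sum]
      refine (Finset.abs_sum_le_sum_abs _ _).trans (Finset.sum_le_sum fun l _ => ?_)
      have h1 : |y l - boolSign (X l)| ≤ 2 :=
        (abs_sub _ _).trans (by rw [hy, abs_boolSign]; norm_num)
      rw [abs_mul, mul_comm]
      exact mul_le_mul_of_nonneg_right h1 (abs_nonneg _)
    have hflip := hclose (Function.update ε k (-ε k))
      (fun l => by
        by_cases hl : l = k
        · subst hl; rw [Function.update_self, abs_neg, hε1]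
        · rw [Function.update_of_ne hl, hε1])
      (fun l hl => by
        have hlk : l ≠ k := fun h => hl (by rw [h]; exact hk)
        rw [Function.update_of_ne hlk, hεX l hl])
    have e : ∑ l, v j l * Function.update ε k (-ε k) l - t j
        = ∑ l, v j l * ε l - t j - 2 * (v j k * ε k) := by
      have : ∀ l, v j l * Function.update ε k (-ε k) l
          = v j l * ε l - if l = k then 2 * (v j k * ε k) else 0 := by
        intro l
        by_cases hl : l = k
        · subst hl; simp; ring
        · simp [hl]
      simp only [this, Finset.sum_sub_distrib, Finset.sum_ite_eq', Finset.mem_univ, if_true]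
      ring
    rw [e] at hflip
    exact mul_nonneg_of_abs_sub_lt (hclose ε hε1 hεX) hflip

end Edge

/-! ### Dissection as a sign change, numerical constants, and conclusion. -/

/-- A dissected edge has its endpoints strictly on different sides of the hyperplane. -/
lemma mul_neg_of_dissects {n : ℕ} {v x y : RSpace n} {t : ℝ}
    (h : Dissects {z | inner ℝ v z = t} x y) : (inner ℝ v x - t) * (inner ℝ v y - t) < 0 := by
  obtain ⟨⟨z, hz, a, b, ha, hb, hab, rfl⟩, hx, hy⟩ := h
  simp only [Set.mem_ofPred_eq, inner_add_right, inner_smul_right] at hz hx hy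
  by_contra! hneg
  have hx' : inner ℝ v x - t ≠ 0 := sub_ne_zero.2 hx
  have hy' : inner ℝ v y - t ≠ 0 := sub_ne_zero.2 hy
  have hpos : 0 < (inner ℝ v x - t) * (inner ℝ v y - t) :=
    lt_of_le_of_ne hneg (mul_ne_zero hx' hy').symm
  have h0 : a * (inner ℝ v x - t) + b * (inner ℝ v y - t) = 0 := by
    linear_combination hz - t * hab
  have h1 : 0 < (inner ℝ v x - t) ^ 2 := by positivity
  have h2 : a * (inner ℝ v x - t) ^ 2 + b * ((inner ℝ v x - t) * (inner ℝ v y - t)) = 0 := by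
    linear_combination (inner ℝ v x - t) * h0
  have h3 : a = 0 := by nlinarith [mul_nonneg ha h1.le, mul_nonneg hb hpos.le]
  have h4 : b = 1 := by linarith
  rw [h3, h4] at h2
  linarith

/-- Raising the hypothesis to the power `3 / 2` gives `m * √m * L ^ 2 ≤ n / 8000`, as `400 ^ (3 / 2)
= 8000`. The logarithmic factors are at most `14 * L` and `6 * L`, and `14 * 32 * 6 = 2688 < 8000`.
-/
lemma log_mul_bound {n m : ℝ} (hn : 2 ≤ n) (hm : 1 ≤ m)
    (h : m ≤ 1 / 400 * (n ^ (2 / 3 : ℝ) / Real.log n ^ (4 / 3 : ℝ))) :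
    (5 * (Real.log (2 * m) + 1 / 25) + 2) * (32 * m * Real.log (1 + n * (2 * n) ^ 2) / n) *
      Real.sqrt m ≤ 1 := by
  have hn0 : 0 < n := by linarith
  have hm0 : 0 < m := by linarith
  have hL2 : 0.69 < Real.log n :=
    lt_of_lt_of_le (by linarith [Real.log_two_gt_d9]) (Real.log_le_log (by norm_num) hn)
  set L := Real.log n with hL
  have hL0 : 0 < L := by linarith
  have hmm : m * Real.sqrt m ≤ 1 / 8000 * (n / L ^ 2) := by
    have h1 : m * Real.sqrt m = m ^ (3 / 2 : ℝ) := by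
      rw [Real.sqrt_eq_rpow, ← Real.rpow_one_add' hm0.le (by norm_num)]
      norm_num
    have h2 : (1 / 400 * (n ^ (2 / 3 : ℝ) / L ^ (4 / 3 : ℝ))) ^ (3 / 2 : ℝ)
        = 1 / 8000 * (n / L ^ 2) := by
      rw [Real.mul_rpow (by norm_num) (by positivity), Real.div_rpow (x := n ^ (2 / 3 : ℝ))
        (by positivity) (by positivity), ← Real.rpow_mul hn0.le, ← Real.rpow_mul hL0.le]
      have : (1 / 400 : ℝ) ^ (3 / 2 : ℝ) = 1 / 8000 := by
        rw [show (1 / 400 : ℝ) = (1 / 20) ^ (2 : ℝ) by norm_num,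
          ← Real.rpow_mul (by norm_num)]
        norm_num
      rw [this]
      norm_num
    rw [h1, ← h2]
    exact Real.rpow_le_rpow hm0.le h (by norm_num)
  have hs1 : 1 ≤ Real.sqrt m := Real.one_le_sqrt.2 hm
  have hLL : 0 < L ^ 2 := by positivity
  have hmmL : m * Real.sqrt m * L ^ 2 ≤ n / 8000 := by
    calc m * Real.sqrt m * L ^ 2 ≤ 1 / 8000 * (n / L ^ 2) * L ^ 2 :=
          mul_le_mul_of_nonneg_right hmm hLL.le
      _ = n / 8000 := by field_simp
  have hmn : m ≤ n := by
    have h1 : m ≤ m * Real.sqrt m := le_mul_of_one_le_right hm0.le hs1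
    have h2 : 0.4 ≤ L ^ 2 := by nlinarith
    nlinarith
  have hlog1 : Real.log (2 * m) ≤ 2 * L := by
    have : 2 * L = Real.log (n ^ 2) := by rw [Real.log_pow, hL]; norm_num
    rw [this]
    exact Real.log_le_log (by linarith) (by nlinarith)
  have hlog2 : Real.log (1 + n * (2 * n) ^ 2) ≤ 6 * L := by
    have : 6 * L = Real.log (n ^ 6) := by rw [Real.log_pow, hL]; norm_num
    rw [this]
    refine Real.log_le_log (by positivity) ?_
    have h3 : 8 ≤ n ^ 3 := by
      calc (8 : ℝ) = 2 ^ 3 := by norm_num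
        _ ≤ n ^ 3 := pow_le_pow_left₀ (by norm_num) hn 3
    nlinarith
  have hlog2' : 0 ≤ Real.log (1 + n * (2 * n) ^ 2) := Real.log_nonneg (by
    have : 0 < n * (2 * n) ^ 2 := by positivity
    linarith)
  have hD : 5 * (Real.log (2 * m) + 1 / 25) + 2 ≤ 14 * L := by linarith
  calc (5 * (Real.log (2 * m) + 1 / 25) + 2) * (32 * m * Real.log (1 + n * (2 * n) ^ 2) / n) *
      Real.sqrt m
      ≤ 14 * L * (32 * m * (6 * L) / n) * Real.sqrt m := by gcongr
    _ = 2688 / n * (m * Real.sqrt m * L ^ 2) := by ring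
    _ ≤ 2688 / n * (n / 8000) := by gcongr
    _ = 2688 / 8000 := by field_simp
    _ ≤ 1 := by norm_num

theorem theorem1 :
    ∃ c : ℝ, 0 < c ∧ ∀ n : ℕ, 2 ≤ n →
      c * ((n : ℝ) ^ (2 / 3 : ℝ) / (Real.log (n : ℝ)) ^ (4 / 3 : ℝ)) ≤ (minHyperplanes n : ℝ) := by
  refine ⟨1 / 400, by norm_num, fun n hn => ?_⟩
  by_contra! hlt
  obtain ⟨A, hAcard, hA, hdis⟩ := (minHyperplanes_isLeast n).1
  have edge : ∀ (ε : Fin n → ℝ) (k : Fin n), (∀ l, |ε l| = 1) →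
      ∃ S ∈ A, Dissects S (WithLp.toLp 2 ε) (WithLp.toLp 2 (Function.update ε k (-ε k))) := by
    intro ε k hε
    refine hdis ⟨WithLp.toLp 2 ε, fun i => eq_or_eq_neg_of_abs_eq (hε i)⟩
      ⟨WithLp.toLp 2 (Function.update ε k (-ε k)), fun i => ?_⟩ ?_
    · refine eq_or_eq_neg_of_abs_eq ?_
      change |Function.update ε k (-ε k) i| = 1
      by_cases hi : i = k
      · subst hi; rw [Function.update_self, abs_neg, hε]
      · rw [Function.update_of_ne hi, hε]
    · change ∑ i, |ε i - Function.update ε k (-ε k) i| = 2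
      rw [Finset.sum_eq_single k]
      · rw [Function.update_self, sub_neg_eq_add, ← two_mul, abs_mul, hε]; norm_num
      · intro i _ hi
        rw [Function.update_of_ne hi, sub_self, abs_zero]
      · intro h; exact absurd (Finset.mem_univ k) h
  have hne : Nonempty A := by
    obtain ⟨S, hS, -⟩ := edge (fun _ => 1) ⟨0, by omega⟩ (by simp)
    exact ⟨⟨S, hS⟩⟩
  choose v t hv ht using fun S : A => hA S.1 S.2
  have hcard : (Fintype.card A : ℝ) = minHyperplanes n := by rw [Fintype.card_coe, hAcard]
  have hm1 : (1 : ℝ) ≤ minHyperplanes n := by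
    rw [← hcard]; exact_mod_cast Fintype.card_pos
  have hsmall := log_mul_bound (by exact_mod_cast hn) hm1 hlt.le
  rw [← hcard] at hsmall
  obtain ⟨ε, k, hε, hsep⟩ := exists_edge_not_separated hn (Fintype.card_fin n)
    (fun S l => v S l) t rfl hsmall
  obtain ⟨S, hS, hd⟩ := edge ε k hε
  have hST := ht ⟨S, hS⟩
  simp only at hST
  rw [hST] at hd
  have hneg := mul_neg_of_dissects hd
  have hin : ∀ y : Fin n → ℝ, inner ℝ (v ⟨S, hS⟩) (WithLp.toLp 2 y) = ∑ l, v ⟨S, hS⟩ l * y l := by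
    intro y
    simp [PiLp.inner_apply, mul_comm]
  have e : ∑ l, v ⟨S, hS⟩ l * Function.update ε k (-ε k) l
      = ∑ l, v ⟨S, hS⟩ l * ε l - 2 * (v ⟨S, hS⟩ k * ε k) := by
    rw [← Finset.add_sum_erase _ _ (Finset.mem_univ k),
      ← Finset.add_sum_erase _ (fun l => v ⟨S, hS⟩ l * ε l) (Finset.mem_univ k),
      Function.update_self, Finset.sum_congr rfl fun l (hl : l ∈ Finset.univ.erase k) => by
        rw [Function.update_of_ne (Finset.ne_of_mem_erase hl)]]
    ring
  rw [hin, hin, e] at hneg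
  have := hsep ⟨S, hS⟩
  simp only at this
  rw [sub_right_comm] at this
  linarith
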